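/- **Setting.** Let $\mathcal X$ be a finite set of $M\ge 2$ hypotheses, $\mathcal U$ a finite non-empty set of experiments, $\mathcal Y$ a finite set of observations, and $\rho_1$ a prior on $\mathcal X$ with $\rho_1(i)>0$ for all $i$. Under true hypothesis $X=i$, experiment $u$ yields, independently of the past, an observation with distribution $p_i^u$ on $\mathcal Y$. An experiment selection strategy $g$ chooses $U_n$ from a distribution $g_n(I_n)$ on $\mathcal U$ depending on the past $I_n=(U_{1:n-1},Y_{1:n-1})$. After $N$ experiments an inference strategy $f$ draws $\hat X_N\in\mathcal X\cup\{\aleph\}$ ($\aleph$ = inconclusive) from a distribution $f(I_{N+1})$. Put $$\psi_N(i)=\mathbb P^{f,g}[\hat X_N=i\mid X=i],\qquad \gamma_N=\mathbb P^{f,g}\Big[\bigcup_{i\in\mathcal X}\{\hat X_N=i,\ X\ne i\}\Big].$$ Let $\gamma_N^*$ be the infimum of $\gamma_N$ over all $(f,g)$ with $\psi_N(i)\ge 1-\epsilon_N$ for every $i\in\mathcal X$ ($\gamma_N^*=\infty$ if there is no such pair). Let $D(p\|q)=\sum_y p(y)\log\frac{p(y)}{q(y)}$, $\lambda^i_j(u,y)=\log\frac{p_i^u(y)}{p_j^u(y)}$,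 and $$D^*(i)=\max_{\alpha\in\Delta\mathcal U}\ \min_{j\ne i}\ \sum_{u}\alpha(u)D(p_i^u\|p_j^u).$$ **Assumptions.** (1) For each $u$ there is a non-empty $\mathcal Y(u)\subseteq\mathcal Y$ that is the support of $p_i^u$ for every $i$. (2) $0<\epsilon_N<1$, $\epsilon_N\to0$ and $-\frac1N\log\epsilon_N\to0$. (3) $D(p_i^u\|p_j^u)>0$ for all $u$ and all $i\ne j$. **Theorem.** (a) $\gamma_N^*$ decays exponentially with exponent $\min_i D^*(i)>0$: $$\lim_{N\to\infty}-\frac1N\log\gamma_N^*=\min_{i\in\mathcal X}D^*(i).$$ (b) The exponent is achieved by ML-switched strategies with confidence thresholds, as follows. Let $B>0$ satisfy $|\lambda^i_j(u,y)|<B$ for all $i,j,u$ and $y\in\mathcal Y(u)$. Let $\rho_n$ be the posterior belief on $X$ given $I_n$, let $\bar\rho_n$ be the posterior obtained when $\rho_1$ is replaced by the uniform prior, and let $\mathcal C_i(\rho)=\log\frac{\rho(i)}{1-\rho(i)}$. Put $s_N=\min\{1,\sqrt{2\log(M/\epsilon_N)/(NB^2)}\}$ and $$\mathscr M_i(u,\rho,s)=\frac{\sum_{j\ne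 i}\rho(j)^s\sum_y p_i^u(y)e^{-s\lambda^i_j(u,y)}}{\sum_{j\ne i}\rho(j)^s}.$$ A strategy $g$ satisfies the selection criterion for $i$ at horizon $N$, with respect to $\alpha^{i*}\in\Delta\mathcal U$, if $\sum_u g_n(I_n)(u)\,\mathscr M_i(u,\rho_n,s_N)\le\sum_u\alpha^{i*}(u)\,\mathscr M_i(u,\rho_n,s_N)$ for all $n\le N$ and all possible histories $I_n$ (those whose observations have positive probability, given their experiments). Then there are thresholds $\theta_N(i)>-\mathcal C_i(\rho_1)$ with $\theta_N(i)/N\to D^*(i)$ such that the following holds. Let $\alpha^{i*}$, $i\in\mathcal X$, be any maximizers in the definition of $D^*(i)$. For each $N$ and $i$ let $g^{N,i}$ be any strategy that satisfies the criterion for $i$ at horizon $N$ with respect to $\alpha^{i*}$. Let $\bar g^N$ use at each time $n$ the rule $g_n^{N,i}$ with $i=\arg\max_k\bar\rho_n(k)$ (ties broken arbitrarily). Let $\bar f^N$ declare $i$ if $\mathcal C_i(\rho_{N+1})-\mathcal C_i(\rho_1)\ge\theta_N(i)$, and $\aleph$ if this holds for no $i$. Then $(\bar f^N,\bar g^N)$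 satisfies $\psi_N(i)\ge1-\epsilon_N$ for all $i\in\mathcal X$ for all sufficiently large $N$, and its misclassification probability satisfies $-\frac1N\log\gamma_N\to\min_{i}D^*(i)$. -/

import Mathlib

open Filter Topology

noncomputable section

/-! Fixed-horizon active hypothesis testing.  `X` is the finite set of hypotheses, `U` the finite
set of experiments, `Y` the finite set of observations.  `ρ` is the prior on `X`, and `p i u` is the
distribution of the observation when experiment `u` is performed under hypothesis `i`. -/

namespace ActiveTesting

variable {X U Y : Type*} [Fintype X] [DecidableEq X] [Fintype U] [Fintype Y]

/-! ### Kullback-Leibler divergence, log-likelihood ratios, assumptions on the model -/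

/-- `D(q ‖ r) = ∑ y, q y log (q y / r y)`. -/
def kl (q r : stdSimplex ℝ Y) : ℝ := ∑ y, q y * Real.log (q y / r y)

/-- Log-likelihood ratio `λ^i_j(u, y) = log (p_i^u(y) / p_j^u(y))`. -/
def llr (p : X → U → stdSimplex ℝ Y) (i j : X) (u : U) (y : Y) : ℝ :=
  Real.log (p i u y / p j u y)

/-- For each experiment, the observation distributions under all hypotheses have the same
(non-empty) support. -/
def CommonSupport (p : X → U → stdSimplex ℝ Y) : Prop :=
  ∀ u, ∃ S : Set Y, S.Nonempty ∧ ∀ i y, 0 < p i u y ↔ y ∈ S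

/-- `min_{j ≠ i} ∑_u α(u) D(p_i^u ‖ p_j^u)`. -/
def minDivergence (p : X → U → stdSimplex ℝ Y) (i : X) (α : stdSimplex ℝ U) : ℝ :=
  ⨅ j : {j : X // j ≠ i}, ∑ u, α u * kl (p i u) (p j u)

/-- Max-min divergence `D*(i) = max_α min_{j ≠ i} ∑_u α(u) D(p_i^u ‖ p_j^u)`. -/
def maxMinDivergence (p : X → U → stdSimplex ℝ Y) (i : X) : ℝ :=
  ⨆ α : stdSimplex ℝ U, minDivergence p i α

/-- `α` is a maximizer in the definition of `D*(i)`. -/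
def IsMaxMinimizer (p : X → U → stdSimplex ℝ Y) (i : X) (α : stdSimplex ℝ U) : Prop :=
  ∀ α' : stdSimplex ℝ U, minDivergence p i α' ≤ minDivergence p i α

/-! ### Strategies and the law they induce -/

/-- The experiments performed and observations obtained in the first `n` steps. -/
abbrev History (U Y : Type*) (n : ℕ) : Type _ := Fin n → U × Y

/-- The first `k` steps of a history of length `n`. -/
def History.prefix {n : ℕ} (h : History U Y n) (k : Fin n) : History U Y k :=
  fun m => h ⟨m, m.isLt.trans k.isLt⟩

/-- An experiment selection strategy: `g n h` is the distribution of the experiment that follows a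
history `h` of `n` steps.  With horizon `N` only the rules with `n < N` are ever used. -/
abbrev Selection (U Y : Type*) [Fintype U] : Type _ := (n : ℕ) → History U Y n → stdSimplex ℝ U

/-- An inference strategy for horizon `N`; `none` is the inconclusive declaration. -/
abbrev Inference (X U Y : Type*) [Fintype X] (N : ℕ) : Type _ :=
  History U Y N → stdSimplex ℝ (Option X)

/-- Probability of the history `h` under strategy `g` given that the true hypothesis is `i`. -/
def historyProb (p : X → U → stdSimplex ℝ Y) (g : Selection U Y) (i : X) {n : ℕ}
    (h : History U Y n) : ℝ :=
  ∏ k : Fin n, g k (h.prefix k) (h k).1 * p i (h k).1 (h k).2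

/-- Joint probability of an event concerning (true hypothesis, history of `N` steps, inference). -/
def prob (ρ : stdSimplex ℝ X) (p : X → U → stdSimplex ℝ Y) {N : ℕ} (g : Selection U Y)
    (f : Inference X U Y N) (E : Set (X × History U Y N × Option X)) : ℝ :=
  ∑ ω, E.indicator (fun ω => ρ ω.1 * historyProb p g ω.1 ω.2.1 * f ω.2.1 ω.2.2) ω

/-- Correct-inference probability of type `i`: the conditional probability of inferring `i` given
that the true hypothesis is `i`. -/
def correctProb (ρ : stdSimplex ℝ X) (p : X → U → stdSimplex ℝ Y) {N : ℕ} (g : Selection U Y)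
    (f : Inference X U Y N) (i : X) : ℝ :=
  prob ρ p g f {ω | ω.2.2 = some i ∧ ω.1 = i} / prob ρ p g f {ω | ω.1 = i}

/-- Misclassification probability: a hypothesis is inferred which is not the true one. -/
def misProb (ρ : stdSimplex ℝ X) (p : X → U → stdSimplex ℝ Y) {N : ℕ} (g : Selection U Y)
    (f : Inference X U Y N) : ℝ :=
  prob ρ p g f (⋃ i : X, {ω | ω.2.2 = some i ∧ ω.1 ≠ i})

/-- The constraint of the symmetric problem. -/
def Feasible (ρ : stdSimplex ℝ X) (p : X → U → stdSimplex ℝ Y) {N : ℕ} (e : ℝ)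
    (g : Selection U Y) (f : Inference X U Y N) : Prop :=
  ∀ i, 1 - e ≤ correctProb ρ p g f i

/-- Optimal (infimum) value of the symmetric problem; it is `⊤` if the problem is infeasible. -/
def optMisProb (ρ : stdSimplex ℝ X) (p : X → U → stdSimplex ℝ Y) (N : ℕ) (e : ℝ) : ENNReal :=
  ⨅ (g : Selection U Y) (f : Inference X U Y N) (_ : Feasible ρ p e g f),
    ENNReal.ofReal (misProb ρ p g f)

/-- `-(1/N) log γ`, as an extended real number. -/
def decayRate (N : ℕ) (γ : ENNReal) : EReal := -(((1 / (N : ℝ) : ℝ) : EReal) * ENNReal.log γ)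

/-! ### Posterior beliefs, confidence levels, and the strategies -/

/-- Posterior belief given a history, from the prior `ρ` (Bayes' rule; the selection probabilities
cancel). -/
def posterior (ρ : stdSimplex ℝ X) (p : X → U → stdSimplex ℝ Y) {n : ℕ} (h : History U Y n)
    (i : X) : ℝ :=
  (ρ i * ∏ k, p i (h k).1 (h k).2) / ∑ j, ρ j * ∏ k, p j (h k).1 (h k).2

/-- The history has positive probability under some hypothesis, given its experiments. -/
def Possible (p : X → U → stdSimplex ℝ Y) {n : ℕ} (h : History U Y n) : Prop :=
  ∃ i, ∀ k, 0 < p i (h k).1 (h k).2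

/-- Confidence level of hypothesis `i` under a belief `b`. -/
def confidence (b : X → ℝ) (i : X) : ℝ := Real.log (b i / (1 - b i))

/-- Moment generating function `E_i exp(-s λ^i_j(u, Y))`. -/
def mgfLlr (p : X → U → stdSimplex ℝ Y) (i j : X) (u : U) (s : ℝ) : ℝ :=
  ∑ y, p i u y * Real.exp (-s * llr p i j u y)

/-- The belief-weighted average of the moment generating functions over the alternatives. -/
def avgMgf (p : X → U → stdSimplex ℝ Y) (i : X) (u : U) (b : X → ℝ) (s : ℝ) : ℝ :=
  (∑ j ∈ Finset.univ.erase i, b j ^ s * mgfLlr p i j u s) / ∑ j ∈ Finset.univ.erase i, b j ^ s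

/-- `s_N = min {1, √(2 log (M / ε_N) / (N B²))}`, where `M` is the number of hypotheses. -/
def tilt (X : Type*) [Fintype X] (B e : ℝ) (N : ℕ) : ℝ :=
  min 1 (Real.sqrt (2 * Real.log (Fintype.card X / e) / (N * B ^ 2)))

/-- Selection criterion with respect to hypothesis `i`: at every time, and after every possible
history, the chosen distribution over experiments does at least as well as `αs`. -/
def Criterion (ρ : stdSimplex ℝ X) (p : X → U → stdSimplex ℝ Y) (B e : ℝ) (N : ℕ) (i : X)
    (αs : stdSimplex ℝ U) (g : Selection U Y) : Prop :=
  ∀ n < N, ∀ h : History U Y n, Possible p h →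
    ∑ u, g n h u * avgMgf p i u (posterior ρ p h) (tilt X B e N) ≤
      ∑ u, αs u * avgMgf p i u (posterior ρ p h) (tilt X B e N)

/-- `ml` is a maximum likelihood estimator: it maximizes the posterior belief formed from the
uniform prior (ties broken arbitrarily). -/
def IsMLEstimator [Nonempty X] (p : X → U → stdSimplex ℝ Y)
    (ml : (n : ℕ) → History U Y n → X) : Prop :=
  ∀ n (h : History U Y n) (j : X),
    posterior stdSimplex.barycenter p h j ≤ posterior stdSimplex.barycenter p h (ml n h)

/-- Follow at each time the strategy attached to the current estimate. -/
def switched (G : X → Selection U Y) (ml : (n : ℕ) → History U Y n → X) : Selection U Y :=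
  fun n h => G (ml n h) n h

open Classical in
/-- Declare a hypothesis whose confidence increment reaches its threshold; if there is none,
declare the experiments inconclusive. -/
def thresholdInference (ρ : stdSimplex ℝ X) (p : X → U → stdSimplex ℝ Y) {N : ℕ} (θ : X → ℝ) :
    Inference X U Y N :=
  fun h =>
    stdSimplex.vertex
      (if hi : ∃ i, θ i ≤ confidence (posterior ρ p h) i - confidence ρ i then some hi.choose
      else none)

end ActiveTesting

end

/-!
The proof compares a change-of-measure converse with a supermartingale analysis of the posterior
odds.

*Converse.* Under hypothesis `i` a strategy performs each experiment a certain expected number of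
times; divided by `N`, these occupation numbers form an `α` in the simplex. By the chain rule the
divergence between the laws of the `N` steps under `i` and under `j` is
`N ∑_u α(u) D(p_i^u ‖ p_j^u)`, so some `j ≠ i` has divergence at most `N D*(i)`. Data
processing then forces `i` to be declared under `j` with probability at least about
`exp (-N D*(i))` (`le_misProb_of_feasible`). No minimax theorem is needed.

*Achievability.* A hypothesis is declared only if its posterior odds are at least `exp (θ_N(i))` up
to a constant, so that the misclassification probability is at most `exp (-min_i θ_N(i))` up to a
constant, whatever the selection strategy (`misProb_thresholdInference_le`). It remains to see that
the confidence in the truth `i` grows at rate `D*(i)` outside an event of probability `ε_N`. The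
potential is `∑_{j ≠ i} (ρ_n(j) / ρ_n(i))^s` with `s = s_N`. If the estimate is `i`, the selection
criterion for `i` says exactly that the conditional mean of the potential is multiplied by at most
what the fixed distribution `α^{i*}` would give, and this is at most `exp (-s D*(i) + s² B²)`
(`Criterion.sum_mul_oddsPowSum_append_le`). The estimate may be wrong, but since every experiment
separates every pair of hypotheses, the same potential with a fixed exponent and the uniform prior
shows that the estimate after `n` steps is wrong with probability `O(exp (-c n))`
(`sum_historyProb_estimate_ne_le`). Hence after `K_N = O(log (1 / ε_N)) = o(N)` steps all estimates
are correct, outside an event of probability `ε_N / 2`. Killing the process at a wrong estimate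
after time `K_N` and applying Markov's inequality to the potential of the surviving process gives
`one_sub_correctProb_le`; the choice `N s_N² B² = 2 log (M / ε_N)` makes all corrections to
`N D*(i)` in the threshold `o(N)` (`tendsto_targetLevel_div`).
-/

noncomputable section

namespace ActiveTesting

section

variable {X U Y : Type*}

/-! ### Weights of histories -/

/-- The history `h` followed by the experiment-observation pair `x`. -/
def History.append {n : ℕ} (h : History U Y n) (x : U × Y) : History U Y (n + 1) :=
  Fin.snoc (α := fun _ => U × Y) h x

@[simp] lemma History.append_castSucc {n : ℕ} (h : History U Y n) (x : U × Y) (k : Fin n) :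
    h.append x k.castSucc = h k := Fin.snoc_castSucc (α := fun _ => U × Y) x h k

@[simp] lemma History.append_last {n : ℕ} (h : History U Y n) (x : U × Y) :
    h.append x (Fin.last n) = x := Fin.snoc_last (α := fun _ => U × Y) x h

lemma History.prefix_append_castSucc {n : ℕ} (h : History U Y n) (x : U × Y) (k : Fin n) :
    (h.append x).prefix k.castSucc = h.prefix k := by
  funext m
  exact h.append_castSucc x ⟨m, m.isLt.trans k.isLt⟩

lemma History.prefix_append_last {n : ℕ} (h : History U Y n) (x : U × Y) :
    (h.append x).prefix (Fin.last n) = h := by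
  funext m
  exact h.append_castSucc x m

/-- Product along a history of step weights `w n h x`, where `h` is the history so far and `x` the
next experiment-observation pair. The step weights need not sum to one: a process that is killed
on some event has weights that vanish there. -/
def pathWeight (w : (n : ℕ) → History U Y n → U × Y → ℝ) {n : ℕ} (h : History U Y n) : ℝ :=
  ∏ k : Fin n, w k (h.prefix k) (h k)

lemma pathWeight_append (w : (n : ℕ) → History U Y n → U × Y → ℝ) {n : ℕ} (h : History U Y n)
    (x : U × Y) : pathWeight w (h.append x) = pathWeight w h * w n h x := by
  unfold pathWeight
  rw [Fin.prod_univ_castSucc, History.append_last]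
  congr 1
  · refine Finset.prod_congr rfl fun k _ => ?_
    rw [History.append_castSucc]
    exact congrArg (fun h' => w k h' (h k)) (h.prefix_append_castSucc x k)
  · exact congrArg (fun h' => w n h' x) (h.prefix_append_last x)

lemma pathWeight_nonneg {w : (n : ℕ) → History U Y n → U × Y → ℝ} (hw : ∀ n h x, 0 ≤ w n h x)
    {n : ℕ} (h : History U Y n) : 0 ≤ pathWeight w h :=
  Finset.prod_nonneg fun _ _ => hw _ _ _

variable [Fintype Y]

/-- Likelihood of the observations of a history, given its experiments. -/
def likelihood (p : X → U → stdSimplex ℝ Y) (i : X) {n : ℕ} (h : History U Y n) : ℝ :=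
  ∏ k, p i (h k).1 (h k).2

lemma likelihood_append (p : X → U → stdSimplex ℝ Y) (i : X) {n : ℕ}
    (h : History U Y n) (x : U × Y) :
    likelihood p i (h.append x) = likelihood p i h * p i x.1 x.2 := by
  simp [likelihood, Fin.prod_univ_castSucc]

lemma likelihood_nonneg (p : X → U → stdSimplex ℝ Y) (i : X) {n : ℕ} (h : History U Y n) :
    0 ≤ likelihood p i h :=
  Finset.prod_nonneg fun _ _ => stdSimplex.zero_le _ _

lemma pos_iff_of_commonSupport {p : X → U → stdSimplex ℝ Y} (hsupp : CommonSupport p) (i j : X)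
    (u : U) (y : Y) : 0 < p i u y ↔ 0 < p j u y := by
  obtain ⟨S, -, hS⟩ := hsupp u
  rw [hS i y, hS j y]

lemma likelihood_pos_iff (p : X → U → stdSimplex ℝ Y) (i : X) {n : ℕ} (h : History U Y n) :
    0 < likelihood p i h ↔ ∀ k, 0 < p i (h k).1 (h k).2 := by
  refine ⟨fun hh k => (stdSimplex.zero_le _ _).lt_of_ne fun h0 => hh.ne' ?_,
    fun hh => Finset.prod_pos fun k _ => hh k⟩
  exact Finset.prod_eq_zero (Finset.mem_univ k) h0.symm

lemma likelihood_pos_of_pos {p : X → U → stdSimplex ℝ Y} (hsupp : CommonSupport p) {i : X}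
    {n : ℕ} {h : History U Y n} (hi : 0 < likelihood p i h) (j : X) : 0 < likelihood p j h := by
  rw [likelihood_pos_iff] at hi ⊢
  exact fun k => (pos_iff_of_commonSupport hsupp i j _ _).1 (hi k)

variable [Fintype U]

lemma sum_history_succ {n : ℕ} (F : History U Y (n + 1) → ℝ) :
    ∑ h, F h = ∑ h : History U Y n, ∑ x, F (h.append x) := by
  rw [← (Fin.snocEquiv (fun _ : Fin (n + 1) => U × Y)).sum_comp, Fintype.sum_prod_type,
    Finset.sum_comm]
  rfl

/-- A function of the history whose one-step conditional mean grows at most by the factor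
`exp (c n)` has mean at most `exp (∑ c)` times its initial value. -/
lemma sum_pathWeight_mul_le {w : (n : ℕ) → History U Y n → U × Y → ℝ}
    (hw : ∀ n h x, 0 ≤ w n h x) (V : (n : ℕ) → History U Y n → ℝ) (c : ℕ → ℝ) (N : ℕ)
    (hV : ∀ n < N, ∀ h : History U Y n, 0 < pathWeight w h →
      ∑ x, w n h x * V (n + 1) (h.append x) ≤ Real.exp (c n) * V n h) :
    ∀ n ≤ N, ∑ h : History U Y n, pathWeight w h * V n h ≤
      Real.exp (∑ k ∈ Finset.range n, c k) * V 0 Fin.elim0 := by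
  intro n hn
  induction n with
  | zero =>
    rw [Fintype.sum_unique]
    simp only [pathWeight, Finset.univ_eq_empty, Finset.prod_empty, one_mul, Finset.range_zero,
      Finset.sum_empty, Real.exp_zero]
    exact le_of_eq (congrArg (V 0) (Subsingleton.elim _ _))
  | succ n ih =>
    have ih := ih (by omega)
    rw [sum_history_succ]
    calc ∑ h : History U Y n, ∑ x, pathWeight w (h.append x) * V (n + 1) (h.append x)
        = ∑ h : History U Y n, pathWeight w h * ∑ x, w n h x * V (n + 1) (h.append x) := by
          refine Finset.sum_congr rfl fun h _ => ?_
          rw [Finset.mul_sum]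
          exact Finset.sum_congr rfl fun x _ => by rw [pathWeight_append, mul_assoc]
      _ ≤ ∑ h : History U Y n, pathWeight w h * (Real.exp (c n) * V n h) := by
          refine Finset.sum_le_sum fun h _ => ?_
          rcases (pathWeight_nonneg hw h).eq_or_lt with h0 | h0
          · rw [← h0, zero_mul, zero_mul]
          · exact mul_le_mul_of_nonneg_left (hV n (by omega) h h0) h0.le
      _ = Real.exp (c n) * ∑ h : History U Y n, pathWeight w h * V n h := by
          rw [Finset.mul_sum]
          exact Finset.sum_congr rfl fun h _ => by ring
      _ ≤ Real.exp (c n) * (Real.exp (∑ k ∈ Finset.range n, c k) * V 0 Fin.elim0) :=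
          mul_le_mul_of_nonneg_left ih (Real.exp_pos _).le
      _ = _ := by rw [Finset.sum_range_succ, Real.exp_add]; ring

/-- Step weights of the history of experiments and observations under hypothesis `i`. -/
def stepProb (p : X → U → stdSimplex ℝ Y) (g : Selection U Y) (i : X) (n : ℕ)
    (h : History U Y n) (x : U × Y) : ℝ :=
  g n h x.1 * p i x.1 x.2

lemma historyProb_eq_pathWeight (p : X → U → stdSimplex ℝ Y) (g : Selection U Y) (i : X) {n : ℕ}
    (h : History U Y n) : historyProb p g i h = pathWeight (stepProb p g i) h := rfl

lemma stepProb_nonneg (p : X → U → stdSimplex ℝ Y) (g : Selection U Y) (i : X) (n : ℕ)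
    (h : History U Y n) (x : U × Y) : 0 ≤ stepProb p g i n h x :=
  mul_nonneg (stdSimplex.zero_le _ _) (stdSimplex.zero_le _ _)

lemma historyProb_nonneg (p : X → U → stdSimplex ℝ Y) (g : Selection U Y) (i : X) {n : ℕ}
    (h : History U Y n) : 0 ≤ historyProb p g i h :=
  pathWeight_nonneg (stepProb_nonneg p g i) h

lemma historyProb_append (p : X → U → stdSimplex ℝ Y) (g : Selection U Y) (i : X) {n : ℕ}
    (h : History U Y n) (x : U × Y) :
    historyProb p g i (h.append x) = historyProb p g i h * (g n h x.1 * p i x.1 x.2) :=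
  pathWeight_append (stepProb p g i) h x

lemma historyProb_eq_mul_likelihood (p : X → U → stdSimplex ℝ Y) (g : Selection U Y) (i : X)
    {n : ℕ} (h : History U Y n) :
    historyProb p g i h = (∏ k : Fin n, g k (h.prefix k) (h k).1) * likelihood p i h :=
  Finset.prod_mul_distrib

lemma likelihood_pos_of_historyProb_pos {p : X → U → stdSimplex ℝ Y} {g : Selection U Y} {i : X}
    {n : ℕ} {h : History U Y n} (hh : 0 < historyProb p g i h) : 0 < likelihood p i h := by
  refine (likelihood_nonneg p i h).lt_of_ne fun h0 => hh.ne' ?_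
  rw [historyProb_eq_mul_likelihood, ← h0, mul_zero]

lemma sum_stepProb (p : X → U → stdSimplex ℝ Y) (q : stdSimplex ℝ U) (i : X) :
    ∑ x : U × Y, q x.1 * p i x.1 x.2 = 1 := by
  rw [Fintype.sum_prod_type]
  simp [← Finset.mul_sum]

lemma sum_historyProb (p : X → U → stdSimplex ℝ Y) (g : Selection U Y) (i : X) (n : ℕ) :
    ∑ h : History U Y n, historyProb p g i h = 1 := by
  induction n with
  | zero =>
    rw [Fintype.sum_unique]
    simp [historyProb]
  | succ n ih =>
    rw [sum_history_succ]
    simp_rw [historyProb_append, ← Finset.mul_sum, sum_stepProb, mul_one]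
    exact ih

/-! ### Performance of a strategy as sums over histories -/

variable [Fintype X]

lemma prob_eq (ρ : stdSimplex ℝ X) (p : X → U → stdSimplex ℝ Y) {N : ℕ} (g : Selection U Y)
    (f : Inference X U Y N) (E : Set (X × History U Y N × Option X)) [DecidablePred (· ∈ E)] :
    prob ρ p g f E = ∑ j, ∑ h : History U Y N, ∑ o,
      if (j, h, o) ∈ E then ρ j * historyProb p g j h * f h o else 0 := by
  unfold prob
  rw [Fintype.sum_prod_type]
  refine Finset.sum_congr rfl fun j _ => ?_
  rw [Fintype.sum_prod_type]
  refine Finset.sum_congr rfl fun h _ => Finset.sum_congr rfl fun o _ => ?_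
  rw [Set.indicator_apply]

variable [DecidableEq X]

lemma correctProb_eq {ρ : stdSimplex ℝ X} (hρ : ∀ i, 0 < ρ i) (p : X → U → stdSimplex ℝ Y)
    {N : ℕ} (g : Selection U Y) (f : Inference X U Y N) (i : X) :
    correctProb ρ p g f i = ∑ h : History U Y N, historyProb p g i h * f h (some i) := by
  classical
  have h1 : prob ρ p g f {ω | ω.2.2 = some i ∧ ω.1 = i} =
      ρ i * ∑ h : History U Y N, historyProb p g i h * f h (some i) := by
    rw [prob_eq, Finset.sum_eq_single i]
    · rw [Finset.mul_sum]
      refine Finset.sum_congr rfl fun h _ => ?_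
      rw [Finset.sum_eq_single (some i)]
      · simp [mul_assoc]
      · intro o _ ho; simp [ho]
      · simp
    · intro j _ hj; simp [hj]
    · simp
  have h2 : prob ρ p g f {ω | ω.1 = i} = ρ i := by
    rw [prob_eq, Finset.sum_eq_single i]
    · simp [← Finset.mul_sum, sum_historyProb]
    · intro j _ hj; simp [hj]
    · simp
  rw [correctProb, h1, h2, mul_div_cancel_left₀ _ (hρ i).ne']

lemma misProb_eq (ρ : stdSimplex ℝ X) (p : X → U → stdSimplex ℝ Y)
    {N : ℕ} (g : Selection U Y) (f : Inference X U Y N) :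
    misProb ρ p g f = ∑ i, ∑ h : History U Y N, f h (some i) *
      ∑ j ∈ Finset.univ.erase i, ρ j * historyProb p g j h := by
  classical
  rw [misProb, prob_eq]
  have : ∀ j, ∀ h : History U Y N, (∑ o, if (j, h, o) ∈
      (⋃ i : X, {ω : X × History U Y N × Option X | ω.2.2 = some i ∧ ω.1 ≠ i}) then
        ρ j * historyProb p g j h * f h o else 0) =
      ∑ i, if j ≠ i then f h (some i) * (ρ j * historyProb p g j h) else 0 := by
    intro j h
    rw [Fintype.sum_option]
    simp [mul_comm]
  simp_rw [this]
  rw [Finset.sum_comm' (t' := Finset.univ) (s' := fun _ => Finset.univ) (by simp)]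
  simp_rw [Finset.sum_comm (s := (Finset.univ : Finset X))
    (t := (Finset.univ : Finset (History U Y N)))]
  refine Finset.sum_congr rfl fun h _ => ?_
  rw [Finset.sum_comm]
  refine Finset.sum_congr rfl fun i _ => ?_
  rw [Finset.mul_sum, ← Finset.sum_filter]
  refine Finset.sum_congr ?_ fun _ _ => rfl
  ext j; simp

end

section

variable {X U Y : Type*} [Fintype Y]

/-! ### Change of measure and the converse bound -/

/-- `p_j^u(y) = p_i^u(y) exp (-λ^i_j(u, y))`, also off the support, where both sides vanish. -/
lemma eq_mul_exp_neg_llr {p : X → U → stdSimplex ℝ Y} (hsupp : CommonSupport p) (i j : X) (u : U)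
    (y : Y) : p j u y = p i u y * Real.exp (-llr p i j u y) := by
  rcases (stdSimplex.zero_le (p i u) y).eq_or_lt with h | h
  · have : ¬ 0 < p j u y := fun h' =>
      ((pos_iff_of_commonSupport hsupp i j u y).2 h').ne h
    rw [← h, zero_mul]
    exact le_antisymm (not_lt.1 this) (stdSimplex.zero_le _ _)
  · have hj := (pos_iff_of_commonSupport hsupp i j u y).1 h
    rw [llr, ← Real.log_inv, Real.exp_log (inv_pos.2 (div_pos h hj)), inv_div,
      mul_div_cancel₀ _ h.ne']

/-- Log-likelihood ratio of `i` against `j` of a whole history. -/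
def historyLlr (p : X → U → stdSimplex ℝ Y) (i j : X) {n : ℕ} (h : History U Y n) : ℝ :=
  ∑ k, llr p i j (h k).1 (h k).2

lemma historyLlr_append (p : X → U → stdSimplex ℝ Y) (i j : X) {n : ℕ} (h : History U Y n)
    (x : U × Y) :
    historyLlr p i j (h.append x) = historyLlr p i j h + llr p i j x.1 x.2 := by
  simp [historyLlr, Fin.sum_univ_castSucc]

variable [Fintype U]

lemma historyProb_eq_mul_exp {p : X → U → stdSimplex ℝ Y} (hsupp : CommonSupport p)
    (g : Selection U Y) (i j : X) {n : ℕ} (h : History U Y n) :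
    historyProb p g j h = historyProb p g i h * Real.exp (-historyLlr p i j h) := by
  rw [historyLlr, ← Finset.sum_neg_distrib, Real.exp_sum]
  unfold historyProb
  rw [← Finset.prod_mul_distrib]
  refine Finset.prod_congr rfl fun k _ => ?_
  rw [eq_mul_exp_neg_llr hsupp i j, mul_assoc]

/-- Expected number of times that experiment `u` is performed in the first `n` steps, under
hypothesis `i`. -/
def occupation (p : X → U → stdSimplex ℝ Y) (g : Selection U Y) (i : X) (n : ℕ) (u : U) : ℝ :=
  ∑ m ∈ Finset.range n, ∑ h : History U Y m, historyProb p g i h * g m h u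

lemma occupation_nonneg (p : X → U → stdSimplex ℝ Y) (g : Selection U Y) (i : X) (n : ℕ) (u : U) :
    0 ≤ occupation p g i n u :=
  Finset.sum_nonneg fun _ _ => Finset.sum_nonneg fun _ _ =>
    mul_nonneg (historyProb_nonneg p g i _) (stdSimplex.zero_le _ _)

lemma sum_occupation (p : X → U → stdSimplex ℝ Y) (g : Selection U Y) (i : X) (n : ℕ) :
    ∑ u, occupation p g i n u = n := by
  unfold occupation
  rw [Finset.sum_comm]
  have : ∀ m ∈ Finset.range n,
      ∑ u, ∑ h : History U Y m, historyProb p g i h * g m h u = 1 := by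
    intro m _
    rw [Finset.sum_comm]
    simp_rw [← Finset.mul_sum, stdSimplex.sum_eq_one, mul_one]
    exact sum_historyProb p g i m
  rw [Finset.sum_congr rfl this]
  simp

lemma sum_mul_llr (p : X → U → stdSimplex ℝ Y) (q : stdSimplex ℝ U) (i j : X) :
    ∑ x : U × Y, q x.1 * p i x.1 x.2 * llr p i j x.1 x.2 =
      ∑ u, q u * kl (p i u) (p j u) := by
  rw [Fintype.sum_prod_type]
  refine Finset.sum_congr rfl fun u _ => ?_
  rw [kl, Finset.mul_sum]
  exact Finset.sum_congr rfl fun y _ => by rw [llr, mul_assoc]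

/-- Chain rule: the divergence between the laws of the first `n` steps under `i` and under `j`. -/
lemma sum_historyProb_mul_historyLlr (p : X → U → stdSimplex ℝ Y) (g : Selection U Y) (i j : X)
    (n : ℕ) : ∑ h : History U Y n, historyProb p g i h * historyLlr p i j h =
      ∑ u, occupation p g i n u * kl (p i u) (p j u) := by
  induction n with
  | zero => simp [occupation, historyLlr]
  | succ n ih =>
    have hstep : ∀ h : History U Y n,
        ∑ x, historyProb p g i (h.append x) * historyLlr p i j (h.append x) =
          historyProb p g i h * historyLlr p i j h +
            historyProb p g i h * ∑ u, g n h u * kl (p i u) (p j u) := by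
      intro h
      rw [← sum_mul_llr]
      calc ∑ x, historyProb p g i (h.append x) * historyLlr p i j (h.append x)
          = ∑ x : U × Y, (historyProb p g i h * historyLlr p i j h *
              (g n h x.1 * p i x.1 x.2) +
              historyProb p g i h * (g n h x.1 * p i x.1 x.2 * llr p i j x.1 x.2)) := by
            refine Finset.sum_congr rfl fun x _ => ?_
            rw [historyProb_append, historyLlr_append]; ring
        _ = _ := by
            rw [Finset.sum_add_distrib, ← Finset.mul_sum, ← Finset.mul_sum, sum_stepProb, mul_one]
    rw [sum_history_succ, Finset.sum_congr rfl fun h _ => hstep h, Finset.sum_add_distrib, ih]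
    simp only [occupation, Finset.sum_range_succ, add_mul, Finset.sum_add_distrib]
    congr 1
    simp_rw [Finset.mul_sum, Finset.sum_mul]
    rw [Finset.sum_comm]
    exact Finset.sum_congr rfl fun u _ => Finset.sum_congr rfl fun h _ => by ring

/-- Data processing for a randomized test `φ` of `i` against `j`. If `φ` accepts `i` with
probability `a` under `i`, and the divergence of the two laws is at most `C`, then `φ` accepts with
probability at least `a exp (-(C + 1) / a)` under `j`. -/
lemma mul_exp_le_sum_historyProb {p : X → U → stdSimplex ℝ Y} (hsupp : CommonSupport p)
    (g : Selection U Y) (i j : X) {n : ℕ} (φ : History U Y n → ℝ) (h0 : ∀ h, 0 ≤ φ h)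
    (h1 : ∀ h, φ h ≤ 1) {a C : ℝ} (ha : 0 < a)
    (hφ : ∑ h : History U Y n, historyProb p g i h * φ h = a)
    (hC : ∑ h : History U Y n, historyProb p g i h * historyLlr p i j h ≤ C) :
    a * Real.exp (-((C + 1) / a)) ≤ ∑ h : History U Y n, historyProb p g j h * φ h := by
  have hP := fun h : History U Y n => historyProb_nonneg p g i h
  -- The rejection region contributes at least `-1` to the divergence, as `-x ≤ exp (-x)`.
  have hacc : ∑ h : History U Y n, historyProb p g i h * φ h * historyLlr p i j h ≤ C + 1 := by
    have hrej : ∑ h : History U Y n, historyProb p g i h * (1 - φ h) * -historyLlr p i j h ≤ 1 := by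
      calc _ ≤ ∑ h : History U Y n, historyProb p g j h := by
            refine Finset.sum_le_sum fun h _ => ?_
            rw [historyProb_eq_mul_exp hsupp g i j, mul_assoc]
            refine mul_le_mul_of_nonneg_left ?_ (hP h)
            have e1 := Real.add_one_le_exp (-historyLlr p i j h)
            have e2 := Real.exp_pos (-historyLlr p i j h)
            nlinarith [h0 h, h1 h]
        _ = 1 := sum_historyProb p g j n
    have : ∑ h : History U Y n, historyProb p g i h * φ h * historyLlr p i j h =
        ∑ h : History U Y n, historyProb p g i h * historyLlr p i j h +
          ∑ h : History U Y n, historyProb p g i h * (1 - φ h) * -historyLlr p i j h := by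
      rw [← Finset.sum_add_distrib]
      exact Finset.sum_congr rfl fun h _ => by ring
    linarith
  -- Tangent line of `exp (-x)` at `c`, the mean of `x` over the acceptance region.
  set c := (C + 1) / a with hc
  have hca : a * c = C + 1 := mul_div_cancel₀ _ ha.ne'
  calc a * Real.exp (-c)
      ≤ Real.exp (-c) * ((1 + c) * a -
          ∑ h : History U Y n, historyProb p g i h * φ h * historyLlr p i j h) := by
        rw [mul_comm]
        exact mul_le_mul_of_nonneg_left (by linarith) (Real.exp_pos _).le
    _ = ∑ h : History U Y n, historyProb p g i h * φ h *
          (Real.exp (-c) * (1 + c - historyLlr p i j h)) := by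
        rw [← hφ, Finset.mul_sum, ← Finset.sum_sub_distrib, Finset.mul_sum]
        exact Finset.sum_congr rfl fun h _ => by ring
    _ ≤ ∑ h : History U Y n, historyProb p g j h * φ h := by
        refine Finset.sum_le_sum fun h _ => ?_
        rw [historyProb_eq_mul_exp hsupp g i j, mul_right_comm (historyProb p g i h) _ (φ h)]
        refine mul_le_mul_of_nonneg_left ?_ (mul_nonneg (hP h) (h0 h))
        have e1 := Real.add_one_le_exp (c - historyLlr p i j h)
        calc Real.exp (-c) * (1 + c - historyLlr p i j h)
            ≤ Real.exp (-c) * Real.exp (c - historyLlr p i j h) :=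
              mul_le_mul_of_nonneg_left (by linarith) (Real.exp_pos _).le
          _ = _ := by rw [← Real.exp_add]; congr 1; ring

/-! ### The max-min divergence -/

variable [Fintype X]

lemma exists_minDivergence_eq [Nontrivial X] (p : X → U → stdSimplex ℝ Y) (i : X)
    (α : stdSimplex ℝ U) :
    ∃ j, j ≠ i ∧ minDivergence p i α = ∑ u, α u * kl (p i u) (p j u) := by
  obtain ⟨k, hk⟩ := exists_ne i
  have : Nonempty {j : X // j ≠ i} := ⟨⟨k, hk⟩⟩
  obtain ⟨j, hj⟩ := exists_eq_ciInf_of_finite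
    (f := fun j : {j : X // j ≠ i} => ∑ u, α u * kl (p i u) (p j u))
  exact ⟨j, j.2, hj.symm⟩

lemma minDivergence_le (p : X → U → stdSimplex ℝ Y) {i j : X} (hj : j ≠ i) (α : stdSimplex ℝ U) :
    minDivergence p i α ≤ ∑ u, α u * kl (p i u) (p j u) :=
  ciInf_le (Set.finite_range _).bddBelow (⟨j, hj⟩ : {j : X // j ≠ i})

lemma continuous_minDivergence [Nontrivial X] (p : X → U → stdSimplex ℝ Y) (i : X) :
    Continuous (minDivergence p i) := by
  classical
  obtain ⟨k, hk⟩ := exists_ne i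
  have : Nonempty {j : X // j ≠ i} := ⟨⟨k, hk⟩⟩
  have : minDivergence p i = fun α => Finset.univ.inf' Finset.univ_nonempty
      fun j : {j : X // j ≠ i} => ∑ u, α u * kl (p i u) (p j u) := by
    funext α
    rw [Finset.inf'_univ_eq_ciInf]
    rfl
  rw [this]
  refine Continuous.finset_inf'_apply _ fun j _ => continuous_finsetSum _ fun u _ => ?_
  exact ((continuous_apply u).comp continuous_subtype_val).mul continuous_const

instance [Nonempty U] : Nonempty (stdSimplex ℝ U) := ⟨stdSimplex.barycenter⟩

lemma bddAbove_range_minDivergence [Nontrivial X] (p : X → U → stdSimplex ℝ Y) (i : X) :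
    BddAbove (Set.range (minDivergence p i)) :=
  (isCompact_range (continuous_minDivergence p i)).bddAbove

lemma exists_isMaxMinimizer [Nontrivial X] [Nonempty U] (p : X → U → stdSimplex ℝ Y) (i : X) :
    ∃ α, IsMaxMinimizer p i α := by
  obtain ⟨α, -, hα⟩ := isCompact_univ.exists_isMaxOn Set.univ_nonempty
    (continuous_minDivergence p i).continuousOn
  exact ⟨α, fun α' => hα (Set.mem_univ α')⟩

lemma IsMaxMinimizer.minDivergence_eq [Nontrivial X] [Nonempty U] {p : X → U → stdSimplex ℝ Y}
    {i : X} {α : stdSimplex ℝ U} (h : IsMaxMinimizer p i α) :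
    minDivergence p i α = maxMinDivergence p i :=
  le_antisymm (le_ciSup (bddAbove_range_minDivergence p i) α) (ciSup_le h)

lemma maxMinDivergence_pos [Nontrivial X] [Nonempty U] {p : X → U → stdSimplex ℝ Y}
    (hpos : ∀ (u : U) (i j : X), i ≠ j → 0 < kl (p i u) (p j u)) (i : X) :
    0 < maxMinDivergence p i := by
  obtain ⟨α, hα⟩ := exists_isMaxMinimizer p i
  rw [← hα.minDivergence_eq]
  obtain ⟨j, hj, hjα⟩ := exists_minDivergence_eq p i α
  rw [hjα]
  have h0 : ∀ u ∈ Finset.univ, 0 ≤ α u * kl (p i u) (p j u) := fun u _ =>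
    mul_nonneg (stdSimplex.zero_le _ _) (hpos u i j hj.symm).le
  refine (Finset.sum_nonneg h0).lt_of_ne fun h => ?_
  have hz : ∀ u, α u = 0 := fun u =>
    (mul_eq_zero.1
      ((Finset.sum_eq_zero_iff_of_nonneg h0).1 h.symm u (Finset.mem_univ u))).resolve_right
      (hpos u i j hj.symm).ne'
  simpa [hz] using stdSimplex.sum_eq_one α

variable [DecidableEq X]

/-- Converse: some alternative `j` is, on average over the experiments performed under `i`, at
divergence at most `D*(i)` per step, so declaring `i` reliably incurs errors under `j`. -/
lemma le_misProb_of_feasible [Nontrivial X] [Nonempty U]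
    {ρ : stdSimplex ℝ X} (hρ : ∀ i, 0 < ρ i) {r : ℝ} (hr : ∀ i, r ≤ ρ i)
    {p : X → U → stdSimplex ℝ Y} (hsupp : CommonSupport p) {N : ℕ} (hN : 0 < N) {e : ℝ}
    (he : e < 1) (i : X) (hD : 0 ≤ maxMinDivergence p i)
    {g : Selection U Y} {f : Inference X U Y N} (hf : Feasible ρ p e g f) :
    r * ((1 - e) * Real.exp (-((N * maxMinDivergence p i + 1) / (1 - e)))) ≤ misProb ρ p g f := by
  have hN' : (0 : ℝ) < N := Nat.cast_pos.2 hN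
  have hfi := hf i
  rw [correctProb_eq hρ] at hfi
  set a := ∑ h : History U Y N, historyProb p g i h * f h (some i) with ha
  have ha0 : 0 < a := lt_of_lt_of_le (by linarith) hfi
  let α : stdSimplex ℝ U := ⟨fun u => occupation p g i N u / N,
    fun u => div_nonneg (occupation_nonneg p g i N u) hN'.le, by
      rw [← Finset.sum_div, sum_occupation, div_self hN'.ne']⟩
  obtain ⟨j, hj, hjα⟩ := exists_minDivergence_eq p i α
  have hα : minDivergence p i α ≤ maxMinDivergence p i :=
    le_ciSup (bddAbove_range_minDivergence p i) α
  have hC : ∑ h : History U Y N, historyProb p g i h * historyLlr p i j h ≤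
      N * maxMinDivergence p i := by
    rw [sum_historyProb_mul_historyLlr]
    calc ∑ u, occupation p g i N u * kl (p i u) (p j u)
        = N * ∑ u, α u * kl (p i u) (p j u) := by
          rw [Finset.mul_sum]
          refine Finset.sum_congr rfl fun u _ => ?_
          change _ = (N : ℝ) * (occupation p g i N u / N * _)
          field_simp
      _ ≤ _ := by rw [← hjα]; exact mul_le_mul_of_nonneg_left hα hN'.le
  have key := mul_exp_le_sum_historyProb hsupp g i j (fun h => f h (some i))
    (fun h => stdSimplex.zero_le _ _) (fun h => stdSimplex.le_one _ _) ha0 ha.symm hC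
  have hmis : ρ j * ∑ h : History U Y N, historyProb p g j h * f h (some i) ≤ misProb ρ p g f := by
    rw [misProb_eq, Finset.mul_sum]
    have hnn : ∀ (h : History U Y N) (j : X), 0 ≤ ρ j * historyProb p g j h := fun h j =>
      mul_nonneg (stdSimplex.zero_le _ _) (historyProb_nonneg p g j h)
    refine le_trans (Finset.sum_le_sum fun h _ => ?_)
      (Finset.single_le_sum (f := fun i => ∑ h : History U Y N, f h (some i) *
        ∑ j ∈ Finset.univ.erase i, ρ j * historyProb p g j h)
        (fun k _ => Finset.sum_nonneg fun h _ => mul_nonneg (stdSimplex.zero_le _ _)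
          (Finset.sum_nonneg fun j _ => hnn h j)) (Finset.mem_univ i))
    calc ρ j * (historyProb p g j h * f h (some i))
        = f h (some i) * (ρ j * historyProb p g j h) := by ring
      _ ≤ _ := mul_le_mul_of_nonneg_left
          (Finset.single_le_sum (f := fun j => ρ j * historyProb p g j h)
            (fun j _ => hnn h j) (Finset.mem_erase.2 ⟨hj, Finset.mem_univ j⟩))
          (stdSimplex.zero_le _ _)
  refine le_trans ?_ hmis
  refine mul_le_mul (hr j) (le_trans ?_ key) (mul_nonneg (by linarith) (Real.exp_pos _).le)
    (stdSimplex.zero_le _ _)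
  have hnum : 0 ≤ N * maxMinDivergence p i + 1 := by positivity
  refine mul_le_mul hfi (Real.exp_le_exp.2 (neg_le_neg ?_)) (Real.exp_pos _).le ha0.le
  exact div_le_div_of_nonneg_left hnum (by linarith) hfi

end

section

/-! ### Elementary inequalities -/

/-- Exponential moment of a bounded random variable, to second order in the parameter. -/
lemma sum_mul_exp_neg_le {Z : Type*} [Fintype Z] (w f : Z → ℝ) (hw0 : ∀ z, 0 ≤ w z)
    (hw1 : ∑ z, w z = 1) {B s : ℝ} (hB : ∀ z, 0 < w z → |f z| ≤ B) (hs : 0 ≤ s)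
    (hsB : s * B ≤ 1) :
    ∑ z, w z * Real.exp (-s * f z) ≤ Real.exp (-(s * ∑ z, w z * f z) + (s * B) ^ 2) := by
  have hz : ∀ z, w z * Real.exp (-s * f z) ≤ w z * (1 - s * f z + (s * B) ^ 2) := by
    intro z
    rcases (hw0 z).eq_or_lt with h | h
    · rw [← h, zero_mul, zero_mul]
    · refine mul_le_mul_of_nonneg_left ?_ h.le
      have h1 : |-s * f z| ≤ s * B := by
        rw [abs_mul, abs_neg, abs_of_nonneg hs]
        exact mul_le_mul_of_nonneg_left (hB z h) hs
      have h2 := (abs_le.1 (Real.abs_exp_sub_one_sub_id_le (h1.trans hsB))).2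
      have h3 : (-s * f z) ^ 2 ≤ (s * B) ^ 2 := sq_le_sq.2 (h1.trans (le_abs_self _))
      linarith
  calc ∑ z, w z * Real.exp (-s * f z) ≤ ∑ z, w z * (1 - s * f z + (s * B) ^ 2) :=
        Finset.sum_le_sum fun z _ => hz z
    _ = (-(s * ∑ z, w z * f z) + (s * B) ^ 2) + 1 := by
        have : ∀ z, w z * (1 - s * f z + (s * B) ^ 2) =
            (1 + (s * B) ^ 2) * w z - s * (w z * f z) := fun z => by ring
        simp_rw [this]
        rw [Finset.sum_sub_distrib, ← Finset.mul_sum, ← Finset.mul_sum, hw1]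
        ring
    _ ≤ _ := Real.add_one_le_exp _

lemma rpow_sum_le_sum_rpow {ι : Type*} (t : Finset ι) (x : ι → ℝ) (hx : ∀ j, 0 ≤ x j) {s : ℝ}
    (hs0 : 0 < s) (hs1 : s ≤ 1) : (∑ j ∈ t, x j) ^ s ≤ ∑ j ∈ t, x j ^ s := by
  classical
  induction t using Finset.induction_on with
  | empty => simp [Real.zero_rpow hs0.ne']
  | insert a t ha ih =>
    rw [Finset.sum_insert ha, Finset.sum_insert ha]
    exact (Real.rpow_add_le_add_rpow (hx a) (Finset.sum_nonneg fun j _ => hx j) hs0.le hs1).trans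
      (by gcongr)

variable {X U Y : Type*} [Fintype Y]

section

variable [Fintype U]

/-- The exponential moment of the log-likelihood ratio when the experiment is drawn from `q`. The
ratio is treated as one bounded variable on `U × Y`, so that the mean over `q` of the divergences
appears in the exponent. -/
lemma sum_mul_mgfLlr_le (p : X → U → stdSimplex ℝ Y) {B : ℝ}
    (hB : ∀ (i j : X) (u : U) (y : Y), 0 < p i u y → |llr p i j u y| < B)
    (q : stdSimplex ℝ U) (i j : X) {s : ℝ} (hs : 0 ≤ s) (hsB : s * B ≤ 1) :
    ∑ u, q u * mgfLlr p i j u s ≤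
      Real.exp (-(s * ∑ u, q u * kl (p i u) (p j u)) + (s * B) ^ 2) := by
  have := sum_mul_exp_neg_le (fun x : U × Y => q x.1 * p i x.1 x.2)
    (fun x => llr p i j x.1 x.2)
    (fun x => mul_nonneg (stdSimplex.zero_le _ _) (stdSimplex.zero_le _ _)) (sum_stepProb p q i)
    (B := B) (fun x hx => (hB i j x.1 x.2 (pos_of_mul_pos_right hx (stdSimplex.zero_le _ _))).le)
    hs hsB
  rw [sum_mul_llr, Fintype.sum_prod_type] at this
  refine le_trans (le_of_eq (Finset.sum_congr rfl fun u _ => ?_)) this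
  rw [mgfLlr, Finset.mul_sum]
  exact Finset.sum_congr rfl fun y _ => by ring

end

/-! ### Posterior odds and their power sums -/

variable [Fintype X]

/-- Posterior odds of `j` against `i` after the history `h`. -/
def odds (ρ : stdSimplex ℝ X) (p : X → U → stdSimplex ℝ Y) (i j : X) {n : ℕ}
    (h : History U Y n) : ℝ :=
  ρ j * likelihood p j h / (ρ i * likelihood p i h)

lemma odds_nonneg (ρ : stdSimplex ℝ X) (p : X → U → stdSimplex ℝ Y) (i j : X) {n : ℕ}
    (h : History U Y n) : 0 ≤ odds ρ p i j h :=
  div_nonneg (mul_nonneg (stdSimplex.zero_le _ _) (likelihood_nonneg p j h))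
    (mul_nonneg (stdSimplex.zero_le _ _) (likelihood_nonneg p i h))

lemma odds_pos {ρ : stdSimplex ℝ X} (hρ : ∀ i, 0 < ρ i) {p : X → U → stdSimplex ℝ Y}
    (hsupp : CommonSupport p) {i : X} (j : X) {n : ℕ} {h : History U Y n}
    (hi : 0 < likelihood p i h) : 0 < odds ρ p i j h :=
  div_pos (mul_pos (hρ j) (likelihood_pos_of_pos hsupp hi j)) (mul_pos (hρ i) hi)

lemma posterior_eq (ρ : stdSimplex ℝ X) (p : X → U → stdSimplex ℝ Y) {n : ℕ} (h : History U Y n)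
    (j : X) : posterior ρ p h j = ρ j * likelihood p j h / ∑ k, ρ k * likelihood p k h := rfl

lemma sum_mul_likelihood_pos {ρ : stdSimplex ℝ X} (hρ : ∀ i, 0 < ρ i)
    {p : X → U → stdSimplex ℝ Y} {i : X} {n : ℕ} {h : History U Y n}
    (hi : 0 < likelihood p i h) : 0 < ∑ k, ρ k * likelihood p k h :=
  Finset.sum_pos' (fun k _ => mul_nonneg (stdSimplex.zero_le _ _) (likelihood_nonneg p k h))
    ⟨i, Finset.mem_univ i, mul_pos (hρ i) hi⟩

lemma posterior_pos {ρ : stdSimplex ℝ X} (hρ : ∀ i, 0 < ρ i)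
    {p : X → U → stdSimplex ℝ Y} {i : X} {n : ℕ} {h : History U Y n}
    (hi : 0 < likelihood p i h) : 0 < posterior ρ p h i :=
  div_pos (mul_pos (hρ i) hi) (sum_mul_likelihood_pos hρ hi)

lemma posterior_eq_odds_mul {ρ : stdSimplex ℝ X} (hρ : ∀ i, 0 < ρ i)
    {p : X → U → stdSimplex ℝ Y} {i : X} {n : ℕ} {h : History U Y n}
    (hi : 0 < likelihood p i h) (j : X) :
    posterior ρ p h j = odds ρ p i j h * posterior ρ p h i := by
  rw [posterior_eq, posterior_eq, odds, div_mul_div_cancel₀ (mul_pos (hρ i) hi).ne']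

lemma sum_posterior {ρ : stdSimplex ℝ X} (hρ : ∀ i, 0 < ρ i)
    {p : X → U → stdSimplex ℝ Y} {i : X} {n : ℕ} {h : History U Y n}
    (hi : 0 < likelihood p i h) : ∑ j, posterior ρ p h j = 1 := by
  simp_rw [posterior_eq]
  rw [← Finset.sum_div, div_self (sum_mul_likelihood_pos hρ hi).ne']

lemma mul_odds_append_rpow {p : X → U → stdSimplex ℝ Y} (hsupp : CommonSupport p)
    (ρ : stdSimplex ℝ X) (i j : X) (s : ℝ) {n : ℕ} (h : History U Y n) (x : U × Y) :
    p i x.1 x.2 * odds ρ p i j (h.append x) ^ s =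
      odds ρ p i j h ^ s * (p i x.1 x.2 * Real.exp (-s * llr p i j x.1 x.2)) := by
  rcases (stdSimplex.zero_le (p i x.1) x.2).eq_or_lt with h0 | h0
  · rw [← h0]; ring
  · have : odds ρ p i j (h.append x) = odds ρ p i j h * Real.exp (-llr p i j x.1 x.2) := by
      rw [odds, odds, likelihood_append, likelihood_append, eq_mul_exp_neg_llr hsupp i j]
      rw [show ρ j * (likelihood p j h * (p i x.1 x.2 * Real.exp (-llr p i j x.1 x.2))) =
        (ρ j * likelihood p j h * Real.exp (-llr p i j x.1 x.2)) * p i x.1 x.2 by ring,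
        ← mul_assoc, mul_div_mul_right _ _ h0.ne', mul_div_right_comm]
    rw [this, Real.mul_rpow (odds_nonneg ρ p i j h) (Real.exp_pos _).le, ← Real.exp_mul]
    rw [show -llr p i j x.1 x.2 * s = -s * llr p i j x.1 x.2 by ring]
    ring

variable [DecidableEq X]

/-- Sum over the alternatives `j ≠ i` of the `s`-th powers of the posterior odds against `i`. -/
def oddsPowSum (ρ : stdSimplex ℝ X) (p : X → U → stdSimplex ℝ Y) (i : X) (s : ℝ) {n : ℕ}
    (h : History U Y n) : ℝ :=
  ∑ j ∈ Finset.univ.erase i, odds ρ p i j h ^ s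

lemma oddsPowSum_nonneg (ρ : stdSimplex ℝ X) (p : X → U → stdSimplex ℝ Y) (i : X) (s : ℝ) {n : ℕ}
    (h : History U Y n) : 0 ≤ oddsPowSum ρ p i s h :=
  Finset.sum_nonneg fun j _ => Real.rpow_nonneg (odds_nonneg ρ p i j h) s

lemma oddsPowSum_pos [Nontrivial X] {ρ : stdSimplex ℝ X} (hρ : ∀ i, 0 < ρ i)
    {p : X → U → stdSimplex ℝ Y} (hsupp : CommonSupport p) {i : X} (s : ℝ) {n : ℕ}
    {h : History U Y n} (hi : 0 < likelihood p i h) : 0 < oddsPowSum ρ p i s h := by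
  obtain ⟨k, hk⟩ := exists_ne i
  exact Finset.sum_pos (fun j _ => Real.rpow_pos_of_pos (odds_pos hρ hsupp j hi) s)
    ⟨k, Finset.mem_erase.2 ⟨hk, Finset.mem_univ k⟩⟩

section Dynamics

variable [Fintype U]

/-- One-step conditional mean, under `i`, of the power sum of the odds. -/
lemma sum_mul_oddsPowSum_append {p : X → U → stdSimplex ℝ Y} (hsupp : CommonSupport p)
    (ρ : stdSimplex ℝ X) (i : X) (s : ℝ) (q : stdSimplex ℝ U) {n : ℕ} (h : History U Y n) :
    ∑ x : U × Y, q x.1 * p i x.1 x.2 * oddsPowSum ρ p i s (h.append x) =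
      ∑ j ∈ Finset.univ.erase i, odds ρ p i j h ^ s * ∑ u, q u * mgfLlr p i j u s := by
  unfold oddsPowSum
  simp_rw [Finset.mul_sum (Finset.univ.erase i)]
  rw [Finset.sum_comm]
  refine Finset.sum_congr rfl fun j _ => ?_
  rw [Fintype.sum_prod_type, Finset.mul_sum]
  refine Finset.sum_congr rfl fun u _ => ?_
  rw [mgfLlr, Finset.mul_sum, Finset.mul_sum]
  refine Finset.sum_congr rfl fun y _ => ?_
  rw [mul_assoc, mul_odds_append_rpow hsupp ρ i j s h (u, y)]
  ring

/-- If every alternative has divergence at least `δ` from `i` on average over `q`, then choosing the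
experiment from `q` shrinks the power sum of the odds, in conditional mean under `i`. -/
lemma sum_mul_oddsPowSum_append_le {p : X → U → stdSimplex ℝ Y} (hsupp : CommonSupport p) {B : ℝ}
    (hB : ∀ (i j : X) (u : U) (y : Y), 0 < p i u y → |llr p i j u y| < B)
    (ρ : stdSimplex ℝ X) (i : X) {s : ℝ} (hs : 0 ≤ s) (hsB : s * B ≤ 1) (q : stdSimplex ℝ U)
    {δ : ℝ} (hδ : ∀ j, j ≠ i → δ ≤ ∑ u, q u * kl (p i u) (p j u)) {n : ℕ}
    (h : History U Y n) :
    ∑ x : U × Y, q x.1 * p i x.1 x.2 * oddsPowSum ρ p i s (h.append x) ≤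
      Real.exp ((s * B) ^ 2 - s * δ) * oddsPowSum ρ p i s h := by
  rw [sum_mul_oddsPowSum_append hsupp, oddsPowSum, Finset.mul_sum]
  refine Finset.sum_le_sum fun j hj => ?_
  rw [mul_comm]
  refine mul_le_mul_of_nonneg_right ?_ (Real.rpow_nonneg (odds_nonneg ρ p i j h) s)
  refine (sum_mul_mgfLlr_le p hB q i j hs hsB).trans (Real.exp_le_exp.2 ?_)
  have := mul_le_mul_of_nonneg_left (hδ j (Finset.ne_of_mem_erase hj)) hs
  linarith

/-- Normalizing the posterior does not change the belief-weighted average, so the conditional mean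
of the power sum of the odds is governed by `avgMgf`. -/
lemma sum_odds_rpow_mul_mgfLlr [Nontrivial X] {ρ : stdSimplex ℝ X} (hρ : ∀ i, 0 < ρ i)
    {p : X → U → stdSimplex ℝ Y} (hsupp : CommonSupport p) {i : X} (s : ℝ) (q : stdSimplex ℝ U)
    {n : ℕ} {h : History U Y n} (hi : 0 < likelihood p i h) :
    ∑ j ∈ Finset.univ.erase i, odds ρ p i j h ^ s * ∑ u, q u * mgfLlr p i j u s =
      oddsPowSum ρ p i s h * ∑ u, q u * avgMgf p i u (posterior ρ p h) s := by
  have hb := posterior_pos hρ hi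
  have hV := oddsPowSum_pos hρ hsupp s hi
  have havg : ∀ u, avgMgf p i u (posterior ρ p h) s =
      (∑ j ∈ Finset.univ.erase i, odds ρ p i j h ^ s * mgfLlr p i j u s) /
        oddsPowSum ρ p i s h := by
    intro u
    obtain ⟨c, hc, hpow⟩ : ∃ c : ℝ, 0 < c ∧
        ∀ j, posterior ρ p h j ^ s = c * odds ρ p i j h ^ s := by
      refine ⟨posterior ρ p h i ^ s, Real.rpow_pos_of_pos hb s, fun j => ?_⟩
      rw [posterior_eq_odds_mul hρ hi j, Real.mul_rpow (odds_nonneg ρ p i j h) hb.le, mul_comm]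
    unfold avgMgf oddsPowSum
    simp_rw [hpow, mul_assoc]
    rw [← Finset.mul_sum, ← Finset.mul_sum, mul_div_mul_left _ _ hc.ne']
  rw [Finset.mul_sum]
  have hc : ∀ u, oddsPowSum ρ p i s h * (q u * avgMgf p i u (posterior ρ p h) s) =
      ∑ j ∈ Finset.univ.erase i, odds ρ p i j h ^ s * (q u * mgfLlr p i j u s) := by
    intro u
    rw [havg, mul_left_comm, mul_div_cancel₀ _ hV.ne', Finset.mul_sum]
    exact Finset.sum_congr rfl fun j _ => by ring
  simp_rw [hc, Finset.mul_sum]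
  exact Finset.sum_comm

/-- The selection criterion lets the strategy inherit the contraction that drawing the experiment
from `αs` would give. -/
lemma Criterion.sum_mul_oddsPowSum_append_le [Nontrivial X] {ρ : stdSimplex ℝ X}
    (hρ : ∀ i, 0 < ρ i) {p : X → U → stdSimplex ℝ Y} (hsupp : CommonSupport p) {B : ℝ}
    (hB : ∀ (i j : X) (u : U) (y : Y), 0 < p i u y → |llr p i j u y| < B) {e : ℝ} {N : ℕ} {i : X}
    {αs : stdSimplex ℝ U} {g : Selection U Y} (hg : Criterion ρ p B e N i αs g)
    (hs : 0 ≤ tilt X B e N) (hsB : tilt X B e N * B ≤ 1) {n : ℕ} (hn : n < N)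
    {h : History U Y n} (hi : 0 < likelihood p i h) :
    ∑ x : U × Y, g n h x.1 * p i x.1 x.2 * oddsPowSum ρ p i (tilt X B e N) (h.append x) ≤
      Real.exp ((tilt X B e N * B) ^ 2 - tilt X B e N * minDivergence p i αs) *
        oddsPowSum ρ p i (tilt X B e N) h := by
  refine le_trans ?_ (ActiveTesting.sum_mul_oddsPowSum_append_le hsupp hB ρ i hs hsB αs
    (fun j hj => minDivergence_le p hj αs) h)
  rw [sum_mul_oddsPowSum_append hsupp, sum_mul_oddsPowSum_append hsupp,
    sum_odds_rpow_mul_mgfLlr hρ hsupp _ _ hi, sum_odds_rpow_mul_mgfLlr hρ hsupp _ _ hi]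
  exact mul_le_mul_of_nonneg_left (hg n hn h ⟨i, (likelihood_pos_iff p i h).1 hi⟩)
    (oddsPowSum_nonneg ρ p i _ h)

end Dynamics

/-! ### Confidence levels and the threshold inference -/

lemma sum_odds_pos [Nontrivial X] {ρ : stdSimplex ℝ X} (hρ : ∀ i, 0 < ρ i)
    {p : X → U → stdSimplex ℝ Y} (hsupp : CommonSupport p) {i : X} {n : ℕ} {h : History U Y n}
    (hi : 0 < likelihood p i h) : 0 < ∑ j ∈ Finset.univ.erase i, odds ρ p i j h := by
  simpa [oddsPowSum] using oddsPowSum_pos hρ hsupp 1 hi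

lemma confidence_posterior {ρ : stdSimplex ℝ X} (hρ : ∀ i, 0 < ρ i)
    {p : X → U → stdSimplex ℝ Y} {i : X} {n : ℕ} {h : History U Y n}
    (hi : 0 < likelihood p i h) :
    confidence (posterior ρ p h) i = -Real.log (∑ j ∈ Finset.univ.erase i, odds ρ p i j h) := by
  have hb := posterior_pos hρ hi
  have h1 : 1 - posterior ρ p h i =
      (∑ j ∈ Finset.univ.erase i, odds ρ p i j h) * posterior ρ p h i := by
    rw [← sum_posterior hρ hi, ← Finset.add_sum_erase _ _ (Finset.mem_univ i), add_sub_cancel_left,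
      Finset.sum_mul]
    exact Finset.sum_congr rfl fun j _ => posterior_eq_odds_mul hρ hi j
  rw [confidence, h1, div_mul_cancel_right₀ hb.ne', Real.log_inv]

lemma le_confidence_posterior_iff [Nontrivial X] {ρ : stdSimplex ℝ X} (hρ : ∀ i, 0 < ρ i)
    {p : X → U → stdSimplex ℝ Y} (hsupp : CommonSupport p) {i : X} {n : ℕ} {h : History U Y n}
    (hi : 0 < likelihood p i h) (t : ℝ) :
    t ≤ confidence (posterior ρ p h) i ↔
      ∑ j ∈ Finset.univ.erase i, odds ρ p i j h ≤ Real.exp (-t) := by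
  rw [confidence_posterior hρ hi, ← Real.log_le_iff_le_exp (sum_odds_pos hρ hsupp hi)]
  exact le_neg

/-- If the confidence in `i` is below `t`, the power sum of the odds is at least `exp (-s t)`. -/
lemma one_le_exp_mul_oddsPowSum [Nontrivial X] {ρ : stdSimplex ℝ X} (hρ : ∀ i, 0 < ρ i)
    {p : X → U → stdSimplex ℝ Y} (hsupp : CommonSupport p) {i : X} {n : ℕ} {h : History U Y n}
    (hi : 0 < likelihood p i h) {s t : ℝ} (hs0 : 0 < s) (hs1 : s ≤ 1)
    (ht : confidence (posterior ρ p h) i < t) :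
    1 ≤ Real.exp (s * t) * oddsPowSum ρ p i s h := by
  rw [← not_le, le_confidence_posterior_iff hρ hsupp hi, not_le] at ht
  calc (1 : ℝ) = Real.exp (s * t) * Real.exp (-t) ^ s := by
        rw [← Real.exp_mul, ← Real.exp_add, ← Real.exp_zero]
        congr 1
        ring
    _ ≤ _ := by
        refine mul_le_mul_of_nonneg_left ?_ (Real.exp_pos _).le
        exact (Real.rpow_le_rpow (Real.exp_pos _).le ht.le hs0.le).trans
          (rpow_sum_le_sum_rpow _ _ (fun j => odds_nonneg ρ p i j h) hs0 hs1)

lemma half_lt_posterior [Nontrivial X] {ρ : stdSimplex ℝ X} (hρ : ∀ i, 0 < ρ i)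
    {p : X → U → stdSimplex ℝ Y} (hsupp : CommonSupport p) {i : X} {n : ℕ} {h : History U Y n}
    (hi : 0 < likelihood p i h) {t : ℝ} (ht : 0 < t)
    (hc : t ≤ confidence (posterior ρ p h) i) : 1 / 2 < posterior ρ p h i := by
  rw [le_confidence_posterior_iff hρ hsupp hi] at hc
  have hlt : ∑ j ∈ Finset.univ.erase i, odds ρ p i j h < 1 :=
    hc.trans_lt (Real.exp_lt_one_iff.2 (by linarith))
  have hb := posterior_pos hρ hi
  have hsum := sum_posterior hρ hi
  rw [← Finset.add_sum_erase _ _ (Finset.mem_univ i),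
    Finset.sum_congr rfl fun j _ => posterior_eq_odds_mul hρ hi j, ← Finset.sum_mul] at hsum
  nlinarith

/-- Thresholds that exceed `-confidence ρ` leave at most one hypothesis to declare, so a hypothesis
whose confidence reaches its threshold is the declared one. -/
lemma thresholdInference_some_eq_one [Nontrivial X] {ρ : stdSimplex ℝ X} (hρ : ∀ i, 0 < ρ i)
    {p : X → U → stdSimplex ℝ Y} (hsupp : CommonSupport p) {θ : X → ℝ}
    (hθ : ∀ i, -confidence ρ i < θ i) {N : ℕ} {h : History U Y N} {i : X}
    (hi : 0 < likelihood p i h)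
    (hc : θ i + confidence ρ i ≤ confidence (posterior ρ p h) i) :
    (thresholdInference ρ p θ : Inference X U Y N) h (some i) = 1 := by
  have hex : ∃ i, θ i ≤ confidence (posterior ρ p h) i - confidence ρ i := ⟨i, by linarith⟩
  have hch : hex.choose = i := by
    by_contra hne
    have hk := likelihood_pos_of_pos hsupp hi hex.choose
    have h1 := half_lt_posterior hρ hsupp hi (by linarith [hθ i]) hc
    have h2 := half_lt_posterior hρ hsupp hk (t := θ hex.choose + confidence ρ hex.choose)
      (by linarith [hθ hex.choose]) (by linarith [hex.choose_spec])
    have hle : posterior ρ p h hex.choose + posterior ρ p h i ≤ 1 := by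
      rw [← sum_posterior hρ hi, ← Finset.sum_pair hne]
      exact Finset.sum_le_sum_of_subset_of_nonneg (Finset.subset_univ _) fun j _ _ =>
        (posterior_pos hρ (likelihood_pos_of_pos hsupp hi j)).le
    linarith
  unfold thresholdInference
  rw [dif_pos hex, hch]
  simp

lemma confidence_of_thresholdInference_ne_zero {ρ : stdSimplex ℝ X} {p : X → U → stdSimplex ℝ Y}
    {θ : X → ℝ} {N : ℕ} {h : History U Y N} {i : X}
    (hf : (thresholdInference ρ p θ : Inference X U Y N) h (some i) ≠ 0) :
    θ i + confidence ρ i ≤ confidence (posterior ρ p h) i := by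
  unfold thresholdInference at hf
  split_ifs at hf with hex
  · have : hex.choose = i := by
      by_contra hne
      apply hf
      simp [Ne.symm hne]
    have h2 := hex.choose_spec
    rw [this] at h2
    linarith
  · simp at hf

variable [Fintype U]

/-- A hypothesis is declared only when its posterior odds are high, which bounds the
misclassification probability under every selection strategy. -/
lemma misProb_thresholdInference_le [Nontrivial X] {ρ : stdSimplex ℝ X} (hρ : ∀ i, 0 < ρ i)
    {p : X → U → stdSimplex ℝ Y} (hsupp : CommonSupport p) (θ : X → ℝ) {m : ℝ}
    (hm : ∀ i, m ≤ θ i + confidence ρ i) {N : ℕ} (g : Selection U Y) :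
    misProb ρ p g (thresholdInference ρ p θ : Inference X U Y N) ≤ Real.exp (-m) := by
  rw [misProb_eq]
  calc _ ≤ ∑ i, ∑ h : History U Y N, Real.exp (-m) * (ρ i * historyProb p g i h) := by
        refine Finset.sum_le_sum fun i _ => Finset.sum_le_sum fun h _ => ?_
        set f := (thresholdInference ρ p θ : Inference X U Y N)
        have hfpos : 0 ≤ f h (some i) := stdSimplex.zero_le _ _
        have hrhs : 0 ≤ Real.exp (-m) * (ρ i * historyProb p g i h) :=
          mul_nonneg (Real.exp_pos _).le
            (mul_nonneg (stdSimplex.zero_le _ _) (historyProb_nonneg p g i h))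
        by_cases hf : f h (some i) = 0
        · rw [hf, zero_mul]; exact hrhs
        refine le_trans (mul_le_of_le_one_left (Finset.sum_nonneg fun j _ =>
          mul_nonneg (stdSimplex.zero_le _ _) (historyProb_nonneg p g j h))
            (stdSimplex.le_one _ _)) ?_
        rcases (likelihood_nonneg p i h).eq_or_lt with hi | hi
        · have hz : ∀ j, historyProb p g j h = 0 := by
            intro j
            by_contra hne
            have hj := likelihood_pos_of_historyProb_pos
              ((historyProb_nonneg p g j h).lt_of_ne' hne)
            exact (likelihood_pos_of_pos hsupp hj i).ne hi
          simp [hz]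
        · have hodds := (le_confidence_posterior_iff hρ hsupp hi m).1
            ((hm i).trans (confidence_of_thresholdInference_ne_zero hf))
          have hj : ∀ j, ρ j * historyProb p g j h =
              odds ρ p i j h * (ρ i * historyProb p g i h) := by
            intro j
            rw [historyProb_eq_mul_likelihood, historyProb_eq_mul_likelihood, odds]
            have h1 := (hρ i).ne'
            have h2 := hi.ne'
            field_simp
          rw [Finset.sum_congr rfl fun j _ => hj j, ← Finset.sum_mul]
          exact mul_le_mul_of_nonneg_right hodds
            (mul_nonneg (stdSimplex.zero_le _ _) (historyProb_nonneg p g i h))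
    _ = Real.exp (-m) := by
        simp_rw [← Finset.mul_sum, sum_historyProb]
        simp

end

section

variable {X U Y : Type*} [DecidableEq X] [Fintype U] [Fintype Y]

/-! ### The process killed at a late wrong estimate -/

/-- Step weights under `i` of the strategy `g`, killed as soon as the estimate differs from `i`
at some time `n ≥ K`. -/
def killedStep (p : X → U → stdSimplex ℝ Y) (g : Selection U Y) (ml : (n : ℕ) → History U Y n → X)
    (i : X) (K n : ℕ) (h : History U Y n) (x : U × Y) : ℝ :=
  if K ≤ n ∧ ml n h ≠ i then 0 else stepProb p g i n h x

lemma killedStep_nonneg (p : X → U → stdSimplex ℝ Y) (g : Selection U Y)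
    (ml : (n : ℕ) → History U Y n → X) (i : X) (K n : ℕ) (h : History U Y n) (x : U × Y) :
    0 ≤ killedStep p g ml i K n h x := by
  unfold killedStep
  split_ifs
  exacts [le_rfl, stepProb_nonneg p g i n h x]

lemma pathWeight_killedStep_le (p : X → U → stdSimplex ℝ Y) (g : Selection U Y)
    (ml : (n : ℕ) → History U Y n → X) (i : X) (K : ℕ) {n : ℕ} (h : History U Y n) :
    pathWeight (killedStep p g ml i K) h ≤ historyProb p g i h := by
  refine Finset.prod_le_prod (fun k _ => killedStep_nonneg p g ml i K _ _ _) fun k _ => ?_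
  unfold killedStep
  split_ifs
  exacts [stepProb_nonneg p g i _ _ _, le_rfl]

/-- The mass lost by killing is at most the sum of the probabilities of late wrong estimates. -/
lemma one_sub_le_sum_pathWeight_killedStep (p : X → U → stdSimplex ℝ Y) (g : Selection U Y)
    (ml : (n : ℕ) → History U Y n → X) (i : X) (K n : ℕ) :
    1 - ∑ k ∈ Finset.range n with K ≤ k,
        ∑ h : History U Y k, historyProb p g i h * (if ml k h ≠ i then 1 else 0) ≤
      ∑ h : History U Y n, pathWeight (killedStep p g ml i K) h := by
  induction n with
  | zero =>
    rw [Fintype.sum_unique]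
    simp [pathWeight]
  | succ n ih =>
    rw [sum_history_succ]
    simp_rw [pathWeight_append, ← Finset.mul_sum]
    have hstep : ∀ h : History U Y n, ∑ x, killedStep p g ml i K n h x =
        if K ≤ n ∧ ml n h ≠ i then 0 else 1 := by
      intro h
      unfold killedStep
      split_ifs
      · simp
      · exact sum_stepProb p (g n h) i
    simp_rw [hstep]
    by_cases hK : K ≤ n
    · have hr : (Finset.range (n + 1)).filter (K ≤ ·) =
          insert n ((Finset.range n).filter (K ≤ ·)) := by
        ext k; simp only [Finset.mem_filter, Finset.mem_range, Finset.mem_insert]; omega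
      rw [hr, Finset.sum_insert (by simp)]
      have : ∑ h : History U Y n, pathWeight (killedStep p g ml i K) h ≤
          ∑ h : History U Y n, pathWeight (killedStep p g ml i K) h *
              (if K ≤ n ∧ ml n h ≠ i then 0 else 1) +
            ∑ h : History U Y n, historyProb p g i h * (if ml n h ≠ i then 1 else 0) := by
        rw [← Finset.sum_add_distrib]
        refine Finset.sum_le_sum fun h _ => ?_
        by_cases hm : ml n h = i
        · simp [hm]
        · simpa [hm, hK] using pathWeight_killedStep_le p g ml i K h
      linarith
    · have hr : (Finset.range (n + 1)).filter (K ≤ ·) = (Finset.range n).filter (K ≤ ·) := by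
        ext k; simp only [Finset.mem_filter, Finset.mem_range]; omega
      rw [hr]
      simpa [hK] using ih

/-! ### Reliability of the switched strategies -/

variable [Fintype X] [Nontrivial X]

/-- The probability under `i` that the maximum likelihood estimate after `n` steps is wrong decays
geometrically, whatever the selection strategy: each experiment separates every pair. -/
lemma sum_historyProb_estimate_ne_le {p : X → U → stdSimplex ℝ Y} (hsupp : CommonSupport p) {B : ℝ}
    (hB : ∀ (i j : X) (u : U) (y : Y), 0 < p i u y → |llr p i j u y| < B)
    {ml : (n : ℕ) → History U Y n → X} (hml : IsMLEstimator p ml) (g : Selection U Y) (i : X)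
    {s δ : ℝ} (hs : 0 ≤ s) (hsB : s * B ≤ 1) (hδ : ∀ u j, j ≠ i → δ ≤ kl (p i u) (p j u))
    (n : ℕ) :
    ∑ h : History U Y n, historyProb p g i h * (if ml n h ≠ i then 1 else 0) ≤
      Fintype.card X * Real.exp ((s * B) ^ 2 - s * δ) ^ n := by
  set β : stdSimplex ℝ X := stdSimplex.barycenter with hβ
  have hβpos : ∀ j, 0 < β j := fun j => inv_pos.2 (Nat.cast_pos.2 Fintype.card_pos)
  have hmean := sum_pathWeight_mul_le (stepProb_nonneg p g i)
    (fun n h => oddsPowSum β p i s (n := n) h) (fun _ => (s * B) ^ 2 - s * δ) n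
    (fun m _ h _ => sum_mul_oddsPowSum_append_le hsupp hB β i hs hsB (g m h) (fun j hj => by
      calc δ = ∑ u, g m h u * δ := by rw [← Finset.sum_mul, stdSimplex.sum_eq_one, one_mul]
        _ ≤ _ := Finset.sum_le_sum fun u _ =>
          mul_le_mul_of_nonneg_left (hδ u j hj) (stdSimplex.zero_le _ _)) h) n le_rfl
  have hV0 : oddsPowSum β p i s (Fin.elim0 : History U Y 0) ≤ Fintype.card X := by
    have hone : ∀ j, odds β p i j (Fin.elim0 : History U Y 0) = 1 := by
      intro j
      have h1 : β j = β i := rfl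
      rw [odds, h1]
      simp [likelihood, (hβpos i).ne']
    simp only [oddsPowSum, hone, Real.one_rpow, Finset.sum_const, nsmul_eq_mul, mul_one]
    exact_mod_cast Finset.card_le_univ _
  have hexp : Real.exp (∑ _k ∈ Finset.range n, ((s * B) ^ 2 - s * δ)) =
      Real.exp ((s * B) ^ 2 - s * δ) ^ n := by
    rw [Finset.sum_const, Finset.card_range, nsmul_eq_mul, Real.exp_nat_mul]
  rw [hexp, mul_comm] at hmean
  refine le_trans (Finset.sum_le_sum fun h _ => ?_) (hmean.trans
    (mul_le_mul_of_nonneg_right hV0 (pow_nonneg (Real.exp_pos _).le n)))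
  rcases (historyProb_nonneg p g i h).eq_or_lt with h0 | h0
  · rw [← historyProb_eq_pathWeight, ← h0, zero_mul, zero_mul]
  refine mul_le_mul_of_nonneg_left ?_ h0.le
  split_ifs with hne
  · -- A wrong estimate has odds at least one against `i`.
    have hi := likelihood_pos_of_historyProb_pos h0
    have hodds : 1 ≤ odds β p i (ml n h) h := by
      have h1 := hml n h i
      rw [posterior_eq_odds_mul hβpos hi (ml n h)] at h1
      exact le_of_mul_le_mul_right (by rwa [one_mul]) (posterior_pos hβpos hi)
    exact (Real.one_le_rpow hodds hs).trans
      (Finset.single_le_sum (f := fun j => odds β p i j h ^ s)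
        (fun j _ => Real.rpow_nonneg (odds_nonneg β p i j h) s)
        (Finset.mem_erase.2 ⟨hne, Finset.mem_univ _⟩))
  · exact oddsPowSum_nonneg β p i s h

/-- Before time `K` the power sum of the odds may grow slowly; from then on the surviving process
uses the rule of `i`, and it contracts. -/
lemma sum_killedStep_mul_oddsPowSum_le {ρ : stdSimplex ℝ X}
    (hρ : ∀ i, 0 < ρ i) {p : X → U → stdSimplex ℝ Y} (hsupp : CommonSupport p) {B : ℝ}
    (hB : ∀ (i j : X) (u : U) (y : Y), 0 < p i u y → |llr p i j u y| < B) {e : ℝ} {N : ℕ} {i : X}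
    (hkl : ∀ u j, j ≠ i → 0 ≤ kl (p i u) (p j u))
    {αs : stdSimplex ℝ U} (hD : 0 ≤ minDivergence p i αs) {G : X → Selection U Y}
    (hG : Criterion ρ p B e N i αs (G i))
    (hs : 0 ≤ tilt X B e N) (hsB : tilt X B e N * B ≤ 1) (ml : (n : ℕ) → History U Y n → X)
    (K : ℕ) :
    ∑ h : History U Y N, pathWeight (killedStep p (switched G ml) ml i K) h *
        oddsPowSum ρ p i (tilt X B e N) h ≤
      Real.exp (N * (tilt X B e N * B) ^ 2 -
          tilt X B e N * minDivergence p i αs * ((N : ℝ) - K)) *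
        oddsPowSum ρ p i (tilt X B e N) (Fin.elim0 : History U Y 0) := by
  set s := tilt X B e N
  set D := minDivergence p i αs
  have hsD : 0 ≤ s * D := mul_nonneg hs hD
  have hmean := sum_pathWeight_mul_le (killedStep_nonneg p (switched G ml) ml i K)
    (fun n h => oddsPowSum ρ p i s (n := n) h)
    (fun k => (s * B) ^ 2 - if K ≤ k then s * D else 0) N ?_ N le_rfl
  · refine hmean.trans (mul_le_mul_of_nonneg_right (Real.exp_le_exp.2 ?_)
      (oddsPowSum_nonneg ρ p i s _))
    have hsum : ∀ n : ℕ, s * D * ((n : ℝ) - K) ≤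
        ∑ k ∈ Finset.range n, if K ≤ k then s * D else 0 := by
      intro n
      induction n with
      | zero =>
        have : (0 : ℝ) ≤ K := Nat.cast_nonneg K
        simp only [Nat.cast_zero, Finset.range_zero, Finset.sum_empty]
        nlinarith
      | succ n ih =>
        rw [Finset.sum_range_succ]
        by_cases hK : K ≤ n
        · rw [if_pos hK]; push_cast; linarith
        · have h1 : ((n + 1 : ℕ) : ℝ) ≤ K := Nat.cast_le.2 (by omega)
          have h2 : 0 ≤ ∑ k ∈ Finset.range n, if K ≤ k then s * D else 0 :=
            Finset.sum_nonneg fun k _ => by split_ifs <;> simp [hsD]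
          rw [if_neg hK]
          nlinarith
    rw [Finset.sum_sub_distrib, Finset.sum_const, Finset.card_range, nsmul_eq_mul]
    linarith [hsum N]
  · intro n hn h hh
    have hi : 0 < likelihood p i h := likelihood_pos_of_historyProb_pos
      (hh.trans_le (pathWeight_killedStep_le p (switched G ml) ml i K h))
    by_cases hK : K ≤ n
    · by_cases hm : ml n h = i
      · have : ∀ x, killedStep p (switched G ml) ml i K n h x = G i n h x.1 * p i x.1 x.2 := by
          intro x
          simp [killedStep, hm, stepProb, switched]
        simp_rw [this, if_pos hK]
        exact hG.sum_mul_oddsPowSum_append_le hρ hsupp hB hs hsB hn hi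
      · have : ∀ x, killedStep p (switched G ml) ml i K n h x = 0 := by
          intro x
          simp [killedStep, hm, hK]
        simp_rw [this, zero_mul, Finset.sum_const_zero]
        exact mul_nonneg (Real.exp_pos _).le (oddsPowSum_nonneg ρ p i s h)
    · have : ∀ x, killedStep p (switched G ml) ml i K n h x =
          switched G ml n h x.1 * p i x.1 x.2 := by
        intro x
        simp [killedStep, hK, stepProb]
      simp_rw [this, if_neg hK]
      have := sum_mul_oddsPowSum_append_le hsupp hB ρ i hs hsB (switched G ml n h) (δ := 0)
        (fun j hj => Finset.sum_nonneg fun u _ =>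
          mul_nonneg (stdSimplex.zero_le _ _) (hkl u j hj)) h
      simpa using this

/-- Non-asymptotic bound on the probability of not declaring `i` under `i`, with the first `K` steps
written off: a late wrong estimate, or a confidence below the threshold although all late estimates
are correct. -/
lemma one_sub_correctProb_le {ρ : stdSimplex ℝ X}
    (hρ : ∀ i, 0 < ρ i) {p : X → U → stdSimplex ℝ Y} (hsupp : CommonSupport p) {B : ℝ}
    (hB : ∀ (i j : X) (u : U) (y : Y), 0 < p i u y → |llr p i j u y| < B) {e : ℝ} {N : ℕ} {i : X}
    (hkl : ∀ u j, j ≠ i → 0 ≤ kl (p i u) (p j u))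
    {αs : stdSimplex ℝ U} (hD : 0 ≤ minDivergence p i αs) {G : X → Selection U Y}
    (hG : Criterion ρ p B e N i αs (G i))
    (hs0 : 0 < tilt X B e N) (hsB : tilt X B e N * B ≤ 1)
    {ml : (n : ℕ) → History U Y n → X} {r C : ℝ} (hr0 : 0 ≤ r) (hr1 : r < 1) (hC : 0 ≤ C)
    (hml : ∀ n, ∑ h : History U Y n, historyProb p (switched G ml) i h *
      (if ml n h ≠ i then 1 else 0) ≤ C * r ^ n)
    (K : ℕ) {θ : X → ℝ} (hθ : ∀ i, -confidence ρ i < θ i) :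
    1 - correctProb ρ p (switched G ml) (thresholdInference ρ p θ : Inference X U Y N) i ≤
      C * (r ^ K / (1 - r)) + Real.exp (tilt X B e N * (θ i + confidence ρ i) +
        N * (tilt X B e N * B) ^ 2 - tilt X B e N * minDivergence p i αs * ((N : ℝ) - K)) *
        oddsPowSum ρ p i (tilt X B e N) (Fin.elim0 : History U Y 0) := by
  set s := tilt X B e N with hsdef
  have hs1 : s ≤ 1 := min_le_left _ _
  set g := switched G ml
  set f := (thresholdInference ρ p θ : Inference X U Y N)
  set W : History U Y N → ℝ := fun h => pathWeight (killedStep p g ml i K) h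
  set t := θ i + confidence ρ i with ht
  have hpoint : ∀ h : History U Y N, historyProb p g i h * (1 - f h (some i)) ≤
      (historyProb p g i h - W h) + Real.exp (s * t) * (W h * oddsPowSum ρ p i s h) := by
    intro h
    have hW0 : 0 ≤ W h := pathWeight_nonneg (killedStep_nonneg p g ml i K) h
    have hW1 : W h ≤ historyProb p g i h := pathWeight_killedStep_le p g ml i K h
    have hV := oddsPowSum_nonneg ρ p i s h
    have hE := Real.exp_pos (s * t)
    rcases (historyProb_nonneg p g i h).eq_or_lt with h0 | h0
    · have : W h = 0 := le_antisymm (h0 ▸ hW1) hW0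
      rw [this, ← h0]
      simp
    have hi := likelihood_pos_of_historyProb_pos h0
    by_cases hc : t ≤ confidence (posterior ρ p h) i
    · rw [show f h (some i) = 1 from thresholdInference_some_eq_one hρ hsupp hθ hi hc]
      have : 0 ≤ Real.exp (s * t) * (W h * oddsPowSum ρ p i s h) := by positivity
      linarith
    · have h1 := one_le_exp_mul_oddsPowSum hρ hsupp hi hs0 hs1 (not_le.1 hc)
      have h2 : historyProb p g i h * (1 - f h (some i)) ≤ historyProb p g i h :=
        mul_le_of_le_one_right h0.le (by linarith [stdSimplex.zero_le (f h) (some i)])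
      have h3 : W h * 1 ≤ W h * (Real.exp (s * t) * oddsPowSum ρ p i s h) :=
        mul_le_mul_of_nonneg_left h1 hW0
      linarith
  have hsum : 1 - correctProb ρ p g f i ≤ (1 - ∑ h, W h) +
      Real.exp (s * t) * ∑ h, W h * oddsPowSum ρ p i s h := by
    rw [correctProb_eq hρ]
    have h1 := Finset.sum_le_sum fun h (_ : h ∈ Finset.univ) => hpoint h
    simp_rw [mul_sub, mul_one] at h1
    rw [Finset.sum_add_distrib, Finset.sum_sub_distrib, Finset.sum_sub_distrib, sum_historyProb,
      ← Finset.mul_sum] at h1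
    exact h1
  have hkill : 1 - ∑ h, W h ≤ C * (r ^ K / (1 - r)) := by
    have h1 := one_sub_le_sum_pathWeight_killedStep p g ml i K N
    have hico : (Finset.range N).filter (K ≤ ·) = Finset.Ico K N := by
      ext k; simp only [Finset.mem_filter, Finset.mem_range, Finset.mem_Ico]; omega
    have h2 : ∑ k ∈ Finset.range N with K ≤ k,
        ∑ h : History U Y k, historyProb p g i h * (if ml k h ≠ i then 1 else 0) ≤
        C * (r ^ K / (1 - r)) := by
      rw [hico]
      refine (Finset.sum_le_sum fun k _ => hml k).trans ?_
      rw [← Finset.mul_sum]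
      exact mul_le_mul_of_nonneg_left (geom_sum_Ico_le_of_lt_one hr0 hr1) hC
    linarith
  have hV := sum_killedStep_mul_oddsPowSum_le hρ hsupp hB hkl hD hG hs0.le hsB ml K
  refine hsum.trans (add_le_add hkill ?_)
  refine (mul_le_mul_of_nonneg_left hV (Real.exp_pos _).le).trans (le_of_eq ?_)
  rw [← mul_assoc, ← Real.exp_add]
  congr 2
  ring

end

section

/-! ### Asymptotics of the tilt and of the written-off steps -/

section Asymptotics

variable {ε : ℕ → ℝ}

lemma tendsto_log_div_atTop (hε : ∀ N, 0 < ε N ∧ ε N < 1) (hε0 : Tendsto ε atTop (𝓝 0)) {A : ℝ}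
    (hA : 0 < A) : Tendsto (fun N => Real.log (A / ε N)) atTop atTop := by
  refine Real.tendsto_log_atTop.comp (Tendsto.const_mul_atTop hA ?_)
  exact tendsto_inv_nhdsGT_zero.comp
    (tendsto_nhdsWithin_iff.2 ⟨hε0, Eventually.of_forall fun N => (hε N).1⟩)

lemma tendsto_log_div_div (hε : ∀ N, 0 < ε N ∧ ε N < 1)
    (hεlog : Tendsto (fun N : ℕ => -Real.log (ε N) / N) atTop (𝓝 0)) {A : ℝ} (hA : 0 < A) :
    Tendsto (fun N : ℕ => Real.log (A / ε N) / N) atTop (𝓝 0) := by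
  have h := (tendsto_const_div_atTop_nhds_zero_nat (Real.log A)).add hεlog
  rw [add_zero] at h
  refine h.congr fun N => ?_
  rw [Real.log_div hA.ne' (hε N).1.ne']
  ring

variable (X : Type*) [Fintype X] [Nontrivial X]

lemma log_card_div_pos {e : ℝ} (he : 0 < e ∧ e < 1) : 0 < Real.log (Fintype.card X / e) := by
  refine Real.log_pos ((one_lt_div he.1).2 (he.2.trans ?_))
  exact_mod_cast Fintype.one_lt_card (α := X)

lemma tilt_pos {B e : ℝ} (hB : 0 < B) (he : 0 < e ∧ e < 1) {N : ℕ} (hN : 0 < N) :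
    0 < tilt X B e N := by
  have h1 := log_card_div_pos X he
  have h2 : (0 : ℝ) < N := Nat.cast_pos.2 hN
  exact lt_min one_pos (Real.sqrt_pos.2 (by positivity))

lemma tendsto_tilt (B : ℝ) (hε : ∀ N, 0 < ε N ∧ ε N < 1)
    (hεlog : Tendsto (fun N : ℕ => -Real.log (ε N) / N) atTop (𝓝 0)) :
    Tendsto (fun N : ℕ => tilt X B (ε N) N) atTop (𝓝 0) := by
  have hM : (0 : ℝ) < Fintype.card X := Nat.cast_pos.2 Fintype.card_pos
  have h := ((tendsto_log_div_div hε hεlog hM).const_mul (2 / B ^ 2)).sqrt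
  rw [mul_zero, Real.sqrt_zero] at h
  have h' := (tendsto_const_nhds (x := (1 : ℝ))).min h
  rw [min_eq_right zero_le_one] at h'
  refine h'.congr fun N => ?_
  rw [tilt]
  congr 2
  rw [div_mul_div_comm, mul_comm (B ^ 2)]

/-- Since `N s_N² B² = 2 log (M / ε_N)`, the term `log (1 / ε_N) / (N s_N)` is of the order of
`s_N`. -/
lemma tendsto_log_div_mul_tilt {B : ℝ} (hB : 0 < B) (hε : ∀ N, 0 < ε N ∧ ε N < 1)
    (hε0 : Tendsto ε atTop (𝓝 0))
    (hεlog : Tendsto (fun N : ℕ => -Real.log (ε N) / N) atTop (𝓝 0)) {A : ℝ} (hA : 0 < A) :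
    Tendsto (fun N : ℕ => Real.log (A / ε N) / (N * tilt X B (ε N) N)) atTop (𝓝 0) := by
  have hM : (0 : ℝ) < Fintype.card X := Nat.cast_pos.2 Fintype.card_pos
  have hs := tendsto_tilt X B hε hεlog
  have hsq : ∀ᶠ N : ℕ in atTop, 0 < N ∧
      N * tilt X B (ε N) N ^ 2 = 2 / B ^ 2 * Real.log (Fintype.card X / ε N) := by
    filter_upwards [hs.eventually (gt_mem_nhds one_pos), eventually_gt_atTop 0] with N h1 hN
    have hN' : (0 : ℝ) < N := Nat.cast_pos.2 hN
    have hl := log_card_div_pos X (hε N)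
    have : tilt X B (ε N) N =
        Real.sqrt (2 * Real.log (Fintype.card X / ε N) / (N * B ^ 2)) := by
      rcases min_choice 1 (Real.sqrt (2 * Real.log (Fintype.card X / ε N) / (N * B ^ 2))) with h | h
      · rw [tilt, h] at h1; exact absurd h1 (lt_irrefl _)
      · rw [tilt, h]
    refine ⟨hN, ?_⟩
    rw [this, Real.sq_sqrt (by positivity)]
    field_simp
  -- As `s_N ≤ 1`, the product `N s_N` is at least `N s_N²`, which tends to infinity.
  have hNs : Tendsto (fun N : ℕ => N * tilt X B (ε N) N) atTop atTop := by
    refine tendsto_atTop_mono' _ ?_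
      ((tendsto_log_div_atTop hε hε0 hM).const_mul_atTop (by positivity : 0 < 2 / B ^ 2))
    filter_upwards [hsq] with N ⟨hN, h⟩
    rw [← h]
    have h0 := tilt_pos X hB (hε N) hN
    refine mul_le_mul_of_nonneg_left ?_ (Nat.cast_nonneg N)
    rw [sq]
    exact mul_le_of_le_one_left h0.le (min_le_left _ _)
  have hlim := (hs.const_mul (B ^ 2 / 2)).add
    ((tendsto_inv_atTop_zero.comp hNs).const_mul (Real.log A - Real.log (Fintype.card X)))
  rw [mul_zero, mul_zero, add_zero] at hlim
  refine hlim.congr' ?_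
  filter_upwards [hsq] with N ⟨hN, h⟩
  have h0 := tilt_pos X hB (hε N) hN
  have hN' : (0 : ℝ) < N := Nat.cast_pos.2 hN
  rw [Real.log_div hM.ne' (hε N).1.ne'] at h
  have hlog : Real.log (A / ε N) = B ^ 2 / 2 * (N * tilt X B (ε N) N ^ 2) +
      (Real.log A - Real.log (Fintype.card X)) := by
    rw [h, Real.log_div hA.ne' (hε N).1.ne']
    field_simp
    ring
  rw [hlog, Function.comp_apply]
  field_simp

variable {X}

/-- Number of initial steps that are written off in the analysis: later on, wrong estimates have
total probability at most a constant multiple of `e / A`, if their probability decays like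
`exp (-c n)`. -/
def burnIn (c A e : ℝ) : ℕ := ⌈Real.log (A / e) / c⌉₊

lemma exp_neg_pow_burnIn_le {c A e : ℝ} (hc : 0 < c) (hA : 0 < A) (he : 0 < e) :
    Real.exp (-c) ^ burnIn c A e ≤ e / A := by
  have h := Nat.le_ceil (Real.log (A / e) / c)
  rw [div_le_iff₀ hc] at h
  rw [← Real.exp_nat_mul, ← Real.le_log_iff_exp_le (div_pos he hA), ← inv_div, Real.log_inv]
  change _ ≤ ((burnIn c A e : ℕ) : ℝ) * c at h
  linarith

lemma tendsto_burnIn_div (hε : ∀ N, 0 < ε N ∧ ε N < 1) (hε0 : Tendsto ε atTop (𝓝 0))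
    (hεlog : Tendsto (fun N : ℕ => -Real.log (ε N) / N) atTop (𝓝 0)) {c A : ℝ} (hc : 0 < c)
    (hA : 0 < A) : Tendsto (fun N : ℕ => (burnIn c A (ε N) : ℝ) / N) atTop (𝓝 0) := by
  have h := ((tendsto_log_div_div hε hεlog hA).div_const c).add
    (tendsto_const_div_atTop_nhds_zero_nat 1)
  rw [zero_div, zero_add] at h
  refine tendsto_of_tendsto_of_tendsto_of_le_of_le' tendsto_const_nhds h
    (Eventually.of_forall fun N => by positivity) ?_
  filter_upwards [(tendsto_log_div_atTop hε hε0 hA).eventually_ge_atTop 0] with N hN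
  have := (Nat.ceil_lt_add_one (div_nonneg hN hc.le)).le
  calc (burnIn c A (ε N) : ℝ) / N ≤ (Real.log (A / ε N) / c + 1) / N :=
        div_le_div_of_nonneg_right this (Nat.cast_nonneg N)
    _ = _ := by rw [add_div, div_right_comm]

end Asymptotics

lemma decayRate_ofReal (N : ℕ) {x : ℝ} (hx : 0 < x) :
    decayRate N (ENNReal.ofReal x) = ((-(1 / (N : ℝ) * Real.log x) : ℝ) : EReal) := by
  rw [decayRate, ENNReal.log_ofReal_of_pos hx]
  norm_cast

lemma decayRate_antitone (N : ℕ) : Antitone (decayRate N) := by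
  intro a b hab
  refine EReal.neg_le_neg_iff.2 (mul_le_mul_of_nonneg_left (ENNReal.log_monotone hab) ?_)
  exact EReal.coe_nonneg.2 (by positivity)

lemma tendsto_ciInf {X : Type*} [Fintype X] [Nonempty X] {x : ℕ → X → ℝ} {a : X → ℝ}
    (h : ∀ i, Tendsto (fun N => x N i) atTop (𝓝 (a i))) :
    Tendsto (fun N => ⨅ i, x N i) atTop (𝓝 (⨅ i, a i)) := by
  simp_rw [← Finset.inf'_univ_eq_ciInf]
  exact Tendsto.finset_inf'_nhds_apply Finset.univ_nonempty fun i _ => h i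

variable {X U Y : Type*} [Fintype X] [Fintype Y]

/-- Sandwich between the converse bound and an upper bound with exponent `min_i D*(i)`. -/
lemma tendsto_decayRate {ε : ℕ → ℝ} (hε0 : Tendsto ε atTop (𝓝 0)) {D r : ℝ} (hr : 0 < r)
    {γ : ℕ → ENNReal} {m : ℕ → ℝ} (hm : Tendsto (fun N : ℕ => m N / N) atTop (𝓝 D))
    (hlow : ∀ᶠ N : ℕ in atTop, ENNReal.ofReal
      (r * ((1 - ε N) * Real.exp (-((N * D + 1) / (1 - ε N))))) ≤ γ N)
    (hupp : ∀ᶠ N : ℕ in atTop, γ N ≤ ENNReal.ofReal (Real.exp (-m N))) :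
    Tendsto (fun N : ℕ => decayRate N (γ N)) atTop (𝓝 (D : EReal)) := by
  have hone : Tendsto (fun N : ℕ => 1 - ε N) atTop (𝓝 1) := by
    simpa using (tendsto_const_nhds (x := (1 : ℝ))).sub hε0
  have hN0 : Tendsto (fun N : ℕ => 1 / (N : ℝ)) atTop (𝓝 0) :=
    tendsto_const_div_atTop_nhds_zero_nat 1
  have hlim : Tendsto (fun N : ℕ => -(1 / (N : ℝ) * (Real.log r + Real.log (1 - ε N))) +
      (D + 1 / N) / (1 - ε N)) atTop (𝓝 D) := by
    have h1 := (hN0.mul ((hone.log one_ne_zero).const_add (Real.log r))).neg.add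
      ((hN0.const_add D).div hone one_ne_zero)
    simpa using h1
  refine tendsto_of_tendsto_of_tendsto_of_le_of_le'
    ((continuous_coe_real_ereal.tendsto D).comp hm)
    ((continuous_coe_real_ereal.tendsto D).comp hlim) ?_ ?_
  · filter_upwards [hupp] with N h
    refine le_trans (le_of_eq ?_) (decayRate_antitone N h)
    rw [decayRate_ofReal N (Real.exp_pos _), Real.log_exp, Function.comp_apply]
    congr 1
    ring
  · filter_upwards [hlow, hone.eventually (lt_mem_nhds one_pos), eventually_gt_atTop 0]
      with N h h1 hN
    have hN' : (N : ℝ) ≠ 0 := Nat.cast_ne_zero.2 hN.ne'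
    refine (decayRate_antitone N h).trans (le_of_eq ?_)
    rw [decayRate_ofReal N (by positivity), Real.log_mul hr.ne' (by positivity),
      Real.log_mul h1.ne' (Real.exp_pos _).ne', Real.log_exp, Function.comp_apply]
    congr 1
    field_simp
    ring

/-! ### The thresholds -/

/-- The confidence level aimed at in `N` steps, when `D` is the attainable rate of growth of the
confidence, the first `K` steps are written off, and `A / e` bounds the initial power sum of the
odds over the admitted error. -/
def targetLevel (B D A e s : ℝ) (N K : ℕ) : ℝ :=
  ((N : ℝ) - K) * D - N * s * B ^ 2 - Real.log (A / e) / s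

lemma tendsto_targetLevel_div (X : Type*) [Fintype X] [Nontrivial X] {ε : ℕ → ℝ}
    {B : ℝ} (hB : 0 < B) (hε : ∀ N, 0 < ε N ∧ ε N < 1)
    (hε0 : Tendsto ε atTop (𝓝 0))
    (hεlog : Tendsto (fun N : ℕ => -Real.log (ε N) / N) atTop (𝓝 0)) (D : ℝ) {A c A' : ℝ}
    (hA : 0 < A) (hc : 0 < c) (hA' : 0 < A') :
    Tendsto (fun N : ℕ => targetLevel B D A (ε N) (tilt X B (ε N) N) N (burnIn c A' (ε N)) / N)
      atTop (𝓝 D) := by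
  have h := ((((tendsto_burnIn_div hε hε0 hεlog hc hA').const_sub 1).mul_const D).sub
    ((tendsto_tilt X B hε hεlog).mul_const (B ^ 2))).sub
    (tendsto_log_div_mul_tilt X hB hε hε0 hεlog hA)
  simp only [sub_zero, one_mul, zero_mul] at h
  refine h.congr' ?_
  filter_upwards [eventually_gt_atTop 0] with N hN
  have hN' : (N : ℝ) ≠ 0 := Nat.cast_ne_zero.2 hN.ne'
  have hs := (tilt_pos X hB (hε N) hN).ne'
  rw [targetLevel]
  field_simp

lemma rpow_le_one_add {x s : ℝ} (hx : 0 ≤ x) (hs0 : 0 ≤ s) (hs1 : s ≤ 1) : x ^ s ≤ 1 + x := by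
  rcases le_total x 1 with h | h
  · linarith [Real.rpow_le_one hx h hs0]
  · have := Real.rpow_le_rpow_of_exponent_le h hs1
    rw [Real.rpow_one] at this
    linarith

/-- Initial prior odds, as a bound on their power sums that is uniform over exponents in
`[0, 1]`. -/
def priorBound (ρ : stdSimplex ℝ X) (i : X) : ℝ := ∑ j, (1 + ρ j / ρ i)

variable [DecidableEq X] in
lemma oddsPowSum_elim0_le (ρ : stdSimplex ℝ X) (p : X → U → stdSimplex ℝ Y) (i : X) {s : ℝ}
    (hs0 : 0 ≤ s) (hs1 : s ≤ 1) :
    oddsPowSum ρ p i s (Fin.elim0 : History U Y 0) ≤ priorBound ρ i := by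
  have hr : ∀ j, 0 ≤ ρ j / ρ i := fun j =>
    div_nonneg (stdSimplex.zero_le _ _) (stdSimplex.zero_le _ _)
  calc oddsPowSum ρ p i s (Fin.elim0 : History U Y 0)
      = ∑ j ∈ Finset.univ.erase i, (ρ j / ρ i) ^ s := by simp [oddsPowSum, odds, likelihood]
    _ ≤ ∑ j ∈ Finset.univ.erase i, (1 + ρ j / ρ i) :=
        Finset.sum_le_sum fun j _ => rpow_le_one_add (hr j) hs0 hs1
    _ ≤ _ := Finset.sum_le_sum_of_subset_of_nonneg (Finset.subset_univ _) fun j _ _ => by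
        linarith [hr j]

variable [Nontrivial X]

lemma priorBound_pos (ρ : stdSimplex ℝ X) (i : X) : 0 < priorBound ρ i :=
  Finset.sum_pos (fun j _ => by
    have : 0 ≤ ρ j / ρ i := div_nonneg (stdSimplex.zero_le _ _) (stdSimplex.zero_le _ _)
    linarith) Finset.univ_nonempty

variable [DecidableEq X] [Fintype U]

/-- At the target level, both error terms of `one_sub_correctProb_le` are at most `e / 2`. -/
lemma one_sub_le_correctProb {ρ : stdSimplex ℝ X}
    (hρ : ∀ i, 0 < ρ i) {p : X → U → stdSimplex ℝ Y} (hsupp : CommonSupport p) {B : ℝ}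
    (hB : ∀ (i j : X) (u : U) (y : Y), 0 < p i u y → |llr p i j u y| < B) {e : ℝ} (he : 0 < e)
    {N : ℕ} {i : X} {s₀ δ c : ℝ} (hδ0 : 0 ≤ δ) (hδ : ∀ u j, j ≠ i → δ ≤ kl (p i u) (p j u))
    (hs₀ : 0 ≤ s₀) (hs₀B : s₀ * B ≤ 1) (hc : 0 < c) (hcδ : c = s₀ * δ - (s₀ * B) ^ 2)
    {αs : stdSimplex ℝ U} (hD : 0 ≤ minDivergence p i αs) {G : X → Selection U Y}
    (hG : Criterion ρ p B e N i αs (G i))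
    (hs0 : 0 < tilt X B e N) (hsB : tilt X B e N * B ≤ 1)
    {ml : (n : ℕ) → History U Y n → X} (hml : IsMLEstimator p ml)
    {θ : X → ℝ} (hθ : ∀ i, -confidence ρ i < θ i)
    (hθi : θ i + confidence ρ i = targetLevel B (minDivergence p i αs) (2 * priorBound ρ i) e
      (tilt X B e N) N (burnIn c (2 * Fintype.card X / (1 - Real.exp (-c))) e)) :
    1 - e ≤ correctProb ρ p (switched G ml) (thresholdInference ρ p θ : Inference X U Y N) i := by
  set s := tilt X B e N with hs
  set A := 2 * Fintype.card X / (1 - Real.exp (-c)) with hAdef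
  have hr1 : Real.exp (-c) < 1 := Real.exp_lt_one_iff.2 (by linarith)
  have hM : (0 : ℝ) < Fintype.card X := Nat.cast_pos.2 Fintype.card_pos
  have hA : 0 < A := div_pos (by positivity) (by linarith)
  have hQ := priorBound_pos ρ i
  have key := one_sub_correctProb_le hρ hsupp hB (fun u j hj => hδ0.trans (hδ u j hj)) hD hG hs0 hsB
    (Real.exp_pos (-c)).le hr1 hM.le (fun n => by
      have := sum_historyProb_estimate_ne_le hsupp hB hml (switched G ml) i hs₀ hs₀B hδ n
      rwa [show (s₀ * B) ^ 2 - s₀ * δ = -c by rw [hcδ]; ring] at this)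
    (burnIn c A e) hθ
  have h1 : Fintype.card X * (Real.exp (-c) ^ burnIn c A e / (1 - Real.exp (-c))) ≤ e / 2 := by
    calc Fintype.card X * (Real.exp (-c) ^ burnIn c A e / (1 - Real.exp (-c)))
        = A / 2 * Real.exp (-c) ^ burnIn c A e := by rw [hAdef]; ring
      _ ≤ A / 2 * (e / A) := mul_le_mul_of_nonneg_left (exp_neg_pow_burnIn_le hc hA he)
          (by positivity)
      _ = e / 2 := by field_simp
  have h2 : Real.exp (s * (θ i + confidence ρ i) + N * (s * B) ^ 2 -
      s * minDivergence p i αs * ((N : ℝ) - burnIn c A e)) *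
      oddsPowSum ρ p i s (Fin.elim0 : History U Y 0) ≤ e / 2 := by
    have hexp : s * (θ i + confidence ρ i) + N * (s * B) ^ 2 -
        s * minDivergence p i αs * ((N : ℝ) - burnIn c A e) =
        Real.log (e / (2 * priorBound ρ i)) := by
      rw [hθi, targetLevel, ← inv_div (2 * priorBound ρ i) e, Real.log_inv]
      have := hs0.ne'
      field_simp
      ring
    rw [hexp, Real.exp_log (by positivity)]
    calc e / (2 * priorBound ρ i) * oddsPowSum ρ p i s (Fin.elim0 : History U Y 0)
        ≤ e / (2 * priorBound ρ i) * priorBound ρ i :=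
          mul_le_mul_of_nonneg_left (oddsPowSum_elim0_le ρ p i hs0.le (min_le_left _ _))
            (by positivity)
      _ = e / 2 := by field_simp
  linarith

end

section

variable {X U Y : Type*} [Fintype X] [Fintype U] [Fintype Y]

/-! ### Attaining the exponent -/

/-- The log-likelihood ratios take finitely many values. -/
lemma exists_llr_bound (p : X → U → stdSimplex ℝ Y) :
    ∃ B : ℝ, 0 < B ∧ ∀ (i j : X) (u : U) (y : Y), 0 < p i u y → |llr p i j u y| < B := by
  obtain ⟨B, hB⟩ := (Set.finite_range
    (fun x : X × X × U × Y => |llr p x.1 x.2.1 x.2.2.1 x.2.2.2|)).bddAbove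
  refine ⟨max B 0 + 1, by positivity, fun i j u y _ => ?_⟩
  have : |llr p i j u y| ≤ B := hB ⟨(i, j, u, y), rfl⟩
  linarith [le_max_left B 0]

variable [DecidableEq X] [Nontrivial X]

lemma exists_misProb_exponent {ρ : stdSimplex ℝ X} (hρ : ∀ i, 0 < ρ i)
    {p : X → U → stdSimplex ℝ Y} (hsupp : CommonSupport p) {θ : ℕ → X → ℝ} {D : X → ℝ}
    (hθ : ∀ i, Tendsto (fun N : ℕ => θ N i / N) atTop (𝓝 (D i))) :
    ∃ m : ℕ → ℝ, Tendsto (fun N : ℕ => m N / N) atTop (𝓝 (⨅ i, D i)) ∧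
      ∀ᶠ N : ℕ in atTop, ∀ g : Selection U Y,
        misProb ρ p g (thresholdInference ρ p (θ N) : Inference X U Y N) ≤ Real.exp (-m N) := by
  have hlim : ∀ i, Tendsto (fun N : ℕ => (θ N i + confidence ρ i) / N) atTop (𝓝 (D i)) := by
    intro i
    have h := (hθ i).add (tendsto_const_div_atTop_nhds_zero_nat (confidence ρ i))
    rw [add_zero] at h
    exact h.congr fun N => (add_div _ _ _).symm
  refine ⟨fun N => N * ⨅ i, (θ N i + confidence ρ i) / N, ?_, ?_⟩
  · refine (tendsto_ciInf hlim).congr' ?_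
    filter_upwards [eventually_gt_atTop 0] with N hN
    rw [mul_div_cancel_left₀ _ (Nat.cast_ne_zero.2 hN.ne')]
  · filter_upwards [eventually_gt_atTop 0] with N hN g
    have hN' : (0 : ℝ) < N := Nat.cast_pos.2 hN
    refine misProb_thresholdInference_le hρ hsupp (θ N) (fun i => ?_) g
    rw [mul_comm, ← le_div_iff₀ hN']
    exact ciInf_le (Set.finite_range _).bddBelow i

/-- Thresholds with the optimal growth rates for which every switched strategy is eventually
feasible. They depend on the model, on `B` and on `ε`, but not on the choice of the maximizers, of
the selection strategies or of the estimator. -/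
lemma exists_thresholds [Nonempty U] {ρ : stdSimplex ℝ X} (hρ : ∀ i, 0 < ρ i)
    {p : X → U → stdSimplex ℝ Y} (hsupp : CommonSupport p)
    (hpos : ∀ (u : U) (i j : X), i ≠ j → 0 < kl (p i u) (p j u))
    {ε : ℕ → ℝ} (hε : ∀ N, 0 < ε N ∧ ε N < 1) (hε0 : Tendsto ε atTop (𝓝 0))
    (hεlog : Tendsto (fun N : ℕ => -Real.log (ε N) / N) atTop (𝓝 0)) {B : ℝ} (hB0 : 0 < B)
    (hB : ∀ (i j : X) (u : U) (y : Y), 0 < p i u y → |llr p i j u y| < B) :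
    ∃ θ : ℕ → X → ℝ,
      (∀ N i, -confidence ρ i < θ N i) ∧
      (∀ i, Tendsto (fun N : ℕ => θ N i / N) atTop (𝓝 (maxMinDivergence p i))) ∧
      ∀ (αs : X → stdSimplex ℝ U) (G : ℕ → X → Selection U Y)
        (ml : ℕ → (n : ℕ) → History U Y n → X),
        (∀ i, IsMaxMinimizer p i (αs i)) →
        (∀ N i, Criterion ρ p B (ε N) N i (αs i) (G N i)) →
        (∀ N, IsMLEstimator p (ml N)) →
        ∀ᶠ N : ℕ in atTop, Feasible ρ p (ε N) (switched (G N) (ml N))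
          (thresholdInference ρ p (θ N) : Inference X U Y N) := by
  have hDpos := maxMinDivergence_pos hpos
  -- The least divergence `δ` between two hypotheses, over all experiments.
  obtain ⟨δ, hδ0, hδ⟩ : ∃ δ : ℝ, 0 < δ ∧ ∀ i u j, j ≠ i → δ ≤ kl (p i u) (p j u) := by
    obtain ⟨i, j, hij⟩ := exists_pair_ne X
    have : Nonempty (U × {x : X × X // x.2 ≠ x.1}) :=
      ⟨Classical.arbitrary U, ⟨(i, j), hij.symm⟩⟩
    obtain ⟨⟨u, x⟩, hx⟩ := Finite.exists_min
      (fun z : U × {x : X × X // x.2 ≠ x.1} => kl (p z.2.1.1 z.1) (p z.2.1.2 z.1))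
    exact ⟨_, hpos u _ _ x.2.symm, fun i u j hj => hx ⟨u, ⟨(i, j), hj⟩⟩⟩
  -- A fixed tilt `s₀` for which the linear gain `s₀ δ` beats the quadratic loss `(s₀ B)²`.
  set s₀ := min (1 / B) (δ / (2 * B ^ 2)) with hs₀
  have hs₀pos : 0 < s₀ := lt_min (by positivity) (by positivity)
  have hs₀B : s₀ * B ≤ 1 := (le_div_iff₀ hB0).1 (min_le_left _ _)
  have hs₀δ : s₀ * (2 * B ^ 2) ≤ δ := (le_div_iff₀ (by positivity)).1 (min_le_right _ _)
  set c := s₀ * δ - (s₀ * B) ^ 2 with hc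
  have hcpos : 0 < c := by
    have h1 := mul_le_mul_of_nonneg_left hs₀δ hs₀pos.le
    have h2 := mul_pos hs₀pos hδ0
    nlinarith
  set A := 2 * Fintype.card X / (1 - Real.exp (-c)) with hAdef
  have hA : 0 < A := div_pos (by have := Fintype.card_pos (α := X); positivity)
    (by linarith [Real.exp_lt_one_iff.2 (neg_lt_zero.2 hcpos)])
  set t : ℕ → X → ℝ := fun N i => targetLevel B (maxMinDivergence p i) (2 * priorBound ρ i) (ε N)
    (tilt X B (ε N) N) N (burnIn c A (ε N)) with ht
  have htlim : ∀ i, Tendsto (fun N : ℕ => t N i / N) atTop (𝓝 (maxMinDivergence p i)) := fun i =>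
    tendsto_targetLevel_div X hB0 hε hε0 hεlog _ (by linarith [priorBound_pos ρ i]) hcpos hA
  have hteq : ∀ᶠ N : ℕ in atTop, ∀ i, max (t N i) 1 = t N i := by
    refine eventually_all.2 fun i => ?_
    filter_upwards [(htlim i).eventually (lt_mem_nhds (half_lt_self (hDpos i))),
      tendsto_natCast_atTop_atTop.eventually_ge_atTop (2 / maxMinDivergence p i),
      eventually_gt_atTop 0] with N h1 h2 hN
    rw [lt_div_iff₀ (Nat.cast_pos.2 hN)] at h1
    rw [div_le_iff₀ (hDpos i)] at h2
    exact max_eq_left (by linarith)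
  -- The truncation at `1` only serves the finitely many `N` at which `t N i` is small.
  refine ⟨fun N i => max (t N i) 1 - confidence ρ i, fun N i => ?_, fun i => ?_, ?_⟩
  · linarith [le_max_right (t N i) 1]
  · have h := (htlim i).sub (tendsto_const_div_atTop_nhds_zero_nat (confidence ρ i))
    rw [sub_zero] at h
    refine h.congr' ?_
    filter_upwards [hteq] with N hN
    rw [hN i, sub_div]
  · intro αs G ml hαs hG hml
    have hsB := ((tendsto_tilt X B hε hεlog).mul_const B)
    rw [zero_mul] at hsB
    filter_upwards [hteq, hsB.eventually (gt_mem_nhds one_pos), eventually_gt_atTop 0]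
      with N hN h1 hN0 i
    refine one_sub_le_correctProb hρ hsupp hB (hε N).1 hδ0.le (hδ i) hs₀pos.le hs₀B hcpos hc
      (αs := αs i) ((hαs i).minDivergence_eq ▸ (hDpos i).le) (hG N i) (tilt_pos X hB0 (hε N) hN0)
      h1.le (hml N) (fun k => ?_) ?_
    · linarith [le_max_right (t N k) 1]
    · rw [sub_add_cancel, hN i, (hαs i).minDivergence_eq]

end

end ActiveTesting

end

open ActiveTesting in
theorem theorem3 {X U Y : Type*} [Fintype X] [DecidableEq X] [Nontrivial X]
    [Fintype U] [Nonempty U] [Fintype Y]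
    (ρ : stdSimplex ℝ X) (hρ : ∀ i, 0 < ρ i)
    (p : X → U → stdSimplex ℝ Y) (hsupp : CommonSupport p)
    (hpos : ∀ (u : U) (i j : X), i ≠ j → 0 < kl (p i u) (p j u))
    (ε : ℕ → ℝ) (hε : ∀ N, 0 < ε N ∧ ε N < 1) (hε0 : Tendsto ε atTop (𝓝 0))
    (hεlog : Tendsto (fun N : ℕ => -Real.log (ε N) / N) atTop (𝓝 0)) :
    -- the optimal value decays exponentially, with exponent `min_i D*(i)`
    (0 < ⨅ i, maxMinDivergence p i) ∧
    Tendsto (fun N : ℕ => decayRate N (optMisProb ρ p N (ε N))) atTop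
      (𝓝 ((⨅ i, maxMinDivergence p i : ℝ) : EReal)) ∧
    -- the exponent is achieved by the ML-switched strategies with confidence thresholds
    ∀ B : ℝ, 0 < B →
      (∀ (i j : X) (u : U) (y : Y), 0 < p i u y → |llr p i j u y| < B) →
      ∃ θ : ℕ → X → ℝ,
        (∀ N i, -confidence ρ i < θ N i) ∧
        (∀ i, Tendsto (fun N : ℕ => θ N i / N) atTop (𝓝 (maxMinDivergence p i))) ∧
        ∀ (αs : X → stdSimplex ℝ U) (G : ℕ → X → Selection U Y)
          (ml : ℕ → (n : ℕ) → History U Y n → X),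
          (∀ i, IsMaxMinimizer p i (αs i)) →
          (∀ N i, Criterion ρ p B (ε N) N i (αs i) (G N i)) →
          (∀ N, IsMLEstimator p (ml N)) →
          (∀ᶠ N : ℕ in atTop,
            Feasible ρ p (ε N) (switched (G N) (ml N))
              (thresholdInference ρ p (θ N) : Inference X U Y N)) ∧
          Tendsto (fun N : ℕ => decayRate N (ENNReal.ofReal
            (misProb ρ p (switched (G N) (ml N))
              (thresholdInference ρ p (θ N) : Inference X U Y N)))) atTop
            (𝓝 ((⨅ i, maxMinDivergence p i : ℝ) : EReal)) := by
  obtain ⟨i₀, hi₀⟩ := exists_eq_ciInf_of_finite (f := fun i => maxMinDivergence p i)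
  have hDpos := maxMinDivergence_pos hpos
  obtain ⟨k₀, hk₀⟩ := exists_eq_ciInf_of_finite (f := fun i => ρ i)
  have hconv : ∀ᶠ N : ℕ in atTop, ∀ (g : Selection U Y) (f : Inference X U Y N),
      Feasible ρ p (ε N) g f →
      ρ k₀ * ((1 - ε N) * Real.exp (-((N * (⨅ i, maxMinDivergence p i) + 1) / (1 - ε N)))) ≤
        misProb ρ p g f := by
    filter_upwards [eventually_gt_atTop 0] with N hN g f hf
    rw [← hi₀]
    exact le_misProb_of_feasible hρ
      (fun i => hk₀.trans_le (ciInf_le (Set.finite_range _).bddBelow i)) hsupp hN (hε N).2 i₀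
      (hDpos i₀).le hf
  have hach := fun B hB0 hB => exists_thresholds hρ hsupp hpos hε hε0 hεlog (B := B) hB0 hB
  refine ⟨hi₀ ▸ hDpos i₀, ?_, ?_⟩
  · -- Any bound `B` will do, with the maximizers themselves as selection strategies.
    obtain ⟨B, hB0, hB⟩ := exists_llr_bound p
    obtain ⟨θ, hθ, hθlim, hfeas⟩ := hach B hB0 hB
    choose αs hαs using exists_isMaxMinimizer p
    have hml : ∀ n (h : History U Y n), ∃ i, ∀ j,
        posterior stdSimplex.barycenter p h j ≤ posterior stdSimplex.barycenter p h i :=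
      fun n h => Finite.exists_max _
    choose ml hml using hml
    have hf := hfeas αs (fun _ i _ _ => αs i) (fun _ => ml) hαs
      (fun N i n _ h _ => le_rfl) (fun _ => hml)
    obtain ⟨m, hm, hmis⟩ := exists_misProb_exponent hρ hsupp hθlim
    refine tendsto_decayRate hε0 (hρ k₀) hm ?_ ?_
    · filter_upwards [hconv] with N hN
      exact le_iInf fun g => le_iInf fun f => le_iInf fun hgf =>
        ENNReal.ofReal_le_ofReal (hN g f hgf)
    · filter_upwards [hf, hmis] with N h1 h2
      exact iInf_le_of_le _ (iInf_le_of_le _ (iInf_le_of_le h1 (ENNReal.ofReal_le_ofReal (h2 _))))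
  · intro B hB0 hB
    obtain ⟨θ, hθ, hθlim, hfeas⟩ := hach B hB0 hB
    refine ⟨θ, hθ, hθlim, fun αs G ml hαs hG hml => ?_⟩
    have hf := hfeas αs G ml hαs hG hml
    obtain ⟨m, hm, hmis⟩ := exists_misProb_exponent hρ hsupp hθlim
    refine ⟨hf, tendsto_decayRate hε0 (hρ k₀) hm ?_ ?_⟩
    · filter_upwards [hconv, hf] with N hN h1
      exact ENNReal.ofReal_le_ofReal (hN _ _ h1)
    · filter_upwards [hmis] with N h2
      exact ENNReal.ofReal_le_ofReal (h2 _)
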